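/- Let $R$ be a commutative ring with unit, $\Gamma$ a group and $\mathcal H$ a set of subgroups of $\Gamma$ closed under conjugation. A Bredon contramodule for $\mathcal H$ is a contravariant functor from the orbit category (objects the transitive $\Gamma$-sets $\Gamma/K$ with $K\in\mathcal H$, morphisms the $\Gamma$-maps) to $R$-modules; the trivial contramodule $\underline R$ is the constant functor with value $R$. For $H\in\mathcal H$ put $WH=N_\Gamma(H)/H$, let $P^\Gamma_H(K)=R\langle\mathrm{Map}_\Gamma(\Gamma/K,\Gamma/H)\rangle$, on which $WH$ acts from the right through right translations of $\Gamma/H$, and for a left $RWH$-module $U$ let $\mathrm{ind}_\tau U=P^\Gamma_H(-)\otimes_{WH}U$. Let $\mathcal H_H=\{K\in\mathcal H: H<K\}$ with the conjugation action of $WH$, and let $\Sigma\widetilde{\mathcal H}_{H\bullet}$ be the suspension of the augmented simplicial chain complex of the geometric realization $|\mathcal H_H|$: it is $R$ in degree $0$ and, in degree $n\ge 1$, the free $R$-module on the chains $K_0<\dots<K_{n-1}$ in $\mathcal H_H$. The $\mathcal H$-length $\ell(H)$ of $H\in\mathcal H$ is the largest $s$ such that there is a chain $H_0<H_1<\dots<H_s\le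 H$ with all $H_i\in\mathcal H$. **Theorem.** Assume that the $\mathcal H$-lengths of the members of $\mathcal H$ are bounded. For each $H\in\mathcal H$ let $P_{H\bullet}\to\Sigma\widetilde{\mathcal H}_{H\bullet}$ be a $WH$-free resolution, i.e. a quasi-isomorphism from a chain complex of free $RWH$-modules vanishing in negative degrees. Let $\mathcal H/\Gamma$ be a set of representatives of the $\Gamma$-conjugacy classes in $\mathcal H$. Then there is a projective resolution $Q_\bullet$ of $\underline R$ in the category of Bredon contramodules for $\mathcal H$ whose underlying graded contramodule is $$\bigoplus_{H\in\mathcal H/\Gamma}\mathrm{ind}_\tau P_{H\bullet}=\bigoplus_{H\in\mathcal H/\Gamma}P^\Gamma_H(-)\otimes_{WH}P_{H\bullet}.$$ Moreover $Q_\bullet$ can be chosen to be an iterated mapping cone, one $\mathcal H$-length at a time, in the following sense: with respect to this decomposition, the component of the differential of $Q_\bullet$ from the summand $\mathrm{ind}_\tau P_{H\bullet}$ to itself is $\mathrm{ind}_\tau$ of the differential of $P_{H\bullet}$, and its component from the summand of $H$ to the summand of $K\ne H$ is zero whenever $\ell(K)\le\ell(H)$. -/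

import Mathlib

universe u

open CategoryTheory CategoryTheory.Limits
open scoped Pointwise MonoidAlgebra

/-- A class of subgroups of `G`: a set of subgroups closed under conjugation. -/
structure ClassOfSubgroups (G : Type u) [Group G] where
  carrier : Set (Subgroup G)
  conj_mem : ∀ (g : G) {K : Subgroup G}, K ∈ carrier → MulAut.conj g • K ∈ carrier

namespace Bredon

section Orbit

variable {G : Type u} [Group G]

/-- Objects of the orbit category of the class `𝓗`: the transitive `G`-sets `G ⧸ K` with
`K ∈ 𝓗`, recorded by the subgroup `K`. -/
structure Orb (𝓗 : ClassOfSubgroups G) where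
  sub : Subgroup G
  mem : sub ∈ 𝓗.carrier

/-- Morphisms of the orbit category are the `G`-maps `G ⧸ K → G ⧸ L`. -/
instance (𝓗 : ClassOfSubgroups G) : Category.{u} (Orb 𝓗) where
  Hom K L := G ⧸ K.sub →[G] G ⧸ L.sub
  id K := MulActionHom.id G
  comp f g := MulActionHom.comp g f

/-- The `G`-map underlying a morphism of the orbit category. -/
abbrev Orb.toMap {𝓗 : ClassOfSubgroups G} {K L : Orb 𝓗} (f : K ⟶ L) :
    G ⧸ K.sub →[G] G ⧸ L.sub := f

/-- The `𝓗`-length of `H ∈ 𝓗`: the largest `s` for which there is a chain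
`H₀ < H₁ < ⋯ < H_s ≤ H` with all `H_i ∈ 𝓗` (and `⊤` if there is no largest `s`). -/
noncomputable def hLength {𝓗 : ClassOfSubgroups G} (H : Orb 𝓗) : ℕ∞ :=
  Order.height (⟨H.sub, H.mem⟩ : {K : Subgroup G // K ∈ 𝓗.carrier})

/-- `T` is a set of representatives of the `G`-conjugacy classes of members of `𝓗`. -/
def IsSetOfRepresentatives {𝓗 : ClassOfSubgroups G} (T : Set (Orb 𝓗)) : Prop :=
  ∀ K : Orb 𝓗, ∃! H : Orb 𝓗, H ∈ T ∧ ∃ g : G, MulAut.conj g • H.sub = K.sub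

/-- The Weyl group `WH = N_G(H) / H`. -/
abbrev Weyl (H : Subgroup G) : Type u :=
  Subgroup.normalizer (H : Set G) ⧸ H.subgroupOf (Subgroup.normalizer (H : Set G))

/-- An action of a group that is trivial on a normal subgroup is an action of the quotient. -/
@[reducible] def quotientMulAction {N X : Type u} [Group N] (S : Subgroup N) [S.Normal]
    [MulAction N X] (h : ∀ s ∈ S, ∀ x : X, s • x = x) : MulAction (N ⧸ S) X where
  smul q x := Quotient.liftOn' q (fun n => n • x) (by
    intro a b hab
    have hab := QuotientGroup.leftRel_apply.1 hab
    have := congrArg (a • ·) (h _ hab x)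
    simpa [smul_smul] using this.symm)
  one_smul x := one_smul N x
  mul_smul p q x := by
    induction p using QuotientGroup.induction_on
    induction q using QuotientGroup.induction_on
    exact mul_smul _ _ x

end Orbit

section Permutation

variable (R : Type u) [CommRing R]

/-- The permutation representation of `W` on the free `R`-module with basis a `W`-set `X`. -/
noncomputable def permRep (W X : Type u) [Group W] [MulAction W X] :
    Representation R W (X →₀ R) where
  toFun w := Finsupp.lmapDomain R R (w • ·)
  map_one' := by ext; simp
  map_mul' v w := by ext; simp [mul_smul]

end Permutation

section Poset

variable {G : Type u} [Group G]

/-- The poset `𝓗_H = {K ∈ 𝓗 : H < K}`. -/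
abbrev Above (𝓗 : ClassOfSubgroups G) (H : Subgroup G) : Type u :=
  {K : Subgroup G // K ∈ 𝓗.carrier ∧ H < K}

theorem conj_smul_self_of_mem_normalizer {H : Subgroup G} {n : G}
    (hn : n ∈ Subgroup.normalizer (H : Set G)) : MulAut.conj n • H = H := by
  ext x
  rw [Subgroup.mem_pointwise_smul_iff_inv_smul_mem]
  have := (Subgroup.mem_normalizer_iff.1 (inv_mem hn)) x
  simpa [← map_inv] using this.symm

theorem conj_smul_eq_self_of_mem {K : Subgroup G} {n : G} (hn : n ∈ K) :
    MulAut.conj n • K = K :=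
  conj_smul_self_of_mem_normalizer (Subgroup.le_normalizer hn)

/-- The normalizer of `H` acts on `𝓗_H` by conjugation, `n • K = n K n⁻¹`. -/
instance (𝓗 : ClassOfSubgroups G) (H : Subgroup G) :
    MulAction (Subgroup.normalizer (H : Set G)) (Above 𝓗 H) where
  smul n K := ⟨MulAut.conj (n : G) • K.1, 𝓗.conj_mem _ K.2.1, by
    have h : MulAut.conj (n : G) • H < MulAut.conj (n : G) • K.1 := by
      rw [lt_iff_le_not_ge, Subgroup.pointwise_smul_le_pointwise_smul_iff,
        Subgroup.pointwise_smul_le_pointwise_smul_iff, ← lt_iff_le_not_ge]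
      exact K.2.2
    rwa [conj_smul_self_of_mem_normalizer n.2] at h⟩
  one_smul K := Subtype.ext (by
    change MulAut.conj ((1 : Subgroup.normalizer (H : Set G)) : G) • K.1 = K.1
    simp)
  mul_smul m n K := Subtype.ext (by
    change MulAut.conj ((m * n : Subgroup.normalizer (H : Set G)) : G) • K.1 =
      MulAut.conj (m : G) • MulAut.conj (n : G) • K.1
    simp [mul_smul])

/-- The induced action of `WH` on `𝓗_H`. -/
instance weylAbove (𝓗 : ClassOfSubgroups G) (H : Subgroup G) :
    MulAction (Weyl H) (Above 𝓗 H) :=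
  quotientMulAction _ (fun _ hs K =>
    Subtype.ext (conj_smul_eq_self_of_mem (K.2.2.le (Subgroup.mem_subgroupOf.1 hs))))

theorem weyl_smul_strictMono (𝓗 : ClassOfSubgroups G) (H : Subgroup G) (w : Weyl H) :
    StrictMono (fun K : Above 𝓗 H => w • K) := by
  induction w using QuotientGroup.induction_on with
  | H n =>
    intro K L h
    change MulAut.conj (n : G) • K.1 < MulAut.conj (n : G) • L.1
    rw [lt_iff_le_not_ge, Subgroup.pointwise_smul_le_pointwise_smul_iff,
      Subgroup.pointwise_smul_le_pointwise_smul_iff, ← lt_iff_le_not_ge]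
    exact h

/-- The strictly increasing chains `K₀ < ⋯ < K_{n-1}` of `n` elements of `𝓗_H`, i.e. the
`(n-1)`-simplices of the geometric realization `|𝓗_H|`; for `n = 0` there is exactly one, the
empty chain. -/
abbrev Chains (𝓗 : ClassOfSubgroups G) (H : Subgroup G) (n : ℕ) : Type u :=
  {c : Fin n → Above 𝓗 H // StrictMono c}

instance (𝓗 : ClassOfSubgroups G) (H : Subgroup G) (n : ℕ) :
    MulAction (Weyl H) (Chains 𝓗 H n) where
  smul w c := ⟨fun i => w • c.1 i, fun _ _ h => weyl_smul_strictMono 𝓗 H w (c.2 h)⟩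
  one_smul c := Subtype.ext (funext fun i => one_smul _ (c.1 i))
  mul_smul v w c := Subtype.ext (funext fun i => mul_smul v w (c.1 i))

/-- The `i`-th face of a chain: omit its `i`-th member. -/
def face {𝓗 : ClassOfSubgroups G} {H : Subgroup G} {n : ℕ} (i : Fin (n + 1))
    (c : Chains 𝓗 H (n + 1)) : Chains 𝓗 H n :=
  ⟨fun j => c.1 (i.succAbove j), c.2.comp (Fin.strictMono_succAbove i)⟩

variable (R : Type u) [CommRing R]

/-- The simplicial boundary map `(K₀ < ⋯ < K_n) ↦ ∑ i, (-1)^i (K₀ < ⋯ K̂_i ⋯ < K_n)`. On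
one-element chains it is the augmentation `K₀ ↦ 1`. -/
noncomputable def boundary (𝓗 : ClassOfSubgroups G) (H : Subgroup G) (n : ℕ) :
    (Chains 𝓗 H (n + 1) →₀ R) →ₗ[R] (Chains 𝓗 H n →₀ R) :=
  Finsupp.linearCombination R fun c =>
    ∑ i : Fin (n + 1), (-1 : R) ^ (i : ℕ) • Finsupp.single (face i c) (1 : R)

theorem boundary_single (𝓗 : ClassOfSubgroups G) (H : Subgroup G) (n : ℕ)
    (c : Chains 𝓗 H (n + 1)) :
    boundary R 𝓗 H n (Finsupp.single c 1) =
      ∑ i : Fin (n + 1), (-1 : R) ^ (i : ℕ) • Finsupp.single (face i c) (1 : R) := by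
  simp [boundary]

theorem boundary_comp_boundary (𝓗 : ClassOfSubgroups G) (H : Subgroup G) (n : ℕ) :
    boundary R 𝓗 H n ∘ₗ boundary R 𝓗 H (n + 1) = 0 := by
  refine Finsupp.lhom_ext' fun c => LinearMap.ext_ring ?_
  simp only [LinearMap.comp_apply, Finsupp.lsingle_apply, boundary_single, map_sum, map_smul,
    LinearMap.zero_apply, Finset.smul_sum, smul_smul]
  rw [← Finset.sum_product', Finset.univ_product_univ]
  refine Finset.sum_involution (fun p _ => (p.1.succAbove p.2, p.2.predAbove p.1)) ?_ ?_ ?_ ?_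
  · rintro ⟨i, j⟩ -
    have hf : face (j.predAbove i) (face (i.succAbove j) c) = face j (face i c) := by
      apply Subtype.ext
      funext k
      exact congrArg c.1 (Fin.succAbove_succAbove_succAbove_predAbove i j k)
    dsimp only
    rw [hf, ← pow_add, ← pow_add, Fin.neg_one_pow_succAbove_add_predAbove, neg_smul,
      add_neg_cancel]
  · rintro ⟨i, j⟩ - - h
    exact Fin.succAbove_ne i j (congrArg Prod.fst h)
  · intros
    exact Finset.mem_univ _
  · rintro ⟨i, j⟩ -
    simp [Fin.succAbove_succAbove_predAbove, Fin.predAbove_predAbove_succAbove]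

/-- The chain complex of `WH`-modules `Σ 𝓗̃_H`, the suspension of the augmented chain complex of
`|𝓗_H|`: in degree `n` it is free over `R` on the chains with `n` elements, so it is `R` with
trivial action in degree `0`, and the chains of `|𝓗_H|` in degree `n - 1` for `n ≥ 1`. -/
noncomputable def suspAugChains (𝓗 : ClassOfSubgroups G) (H : Subgroup G) :
    ChainComplex (Rep.{u} R (Weyl H)) ℕ :=
  ChainComplex.of (fun n => Rep.of (permRep R (Weyl H) (Chains 𝓗 H n)))
    (fun n => Rep.ofHom ⟨boundary R 𝓗 H n, fun w => by
      refine Finsupp.lhom_ext' fun c => LinearMap.ext_ring ?_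
      simp only [permRep, MonoidHom.coe_mk, OneHom.coe_mk, LinearMap.comp_apply,
        Finsupp.lsingle_apply, Finsupp.lmapDomain_apply, Finsupp.mapDomain_single,
        boundary_single, map_sum, map_smul]
      rfl⟩)
    (fun n => by
      apply Rep.hom_ext
      apply Representation.IntertwiningMap.ext
      exact boundary_comp_boundary R 𝓗 H n)

end Poset

section Contramodules

variable {G : Type u} [Group G]

/-- Right translation `gH ↦ g n H` of `G ⧸ H` by an element `n` of the normalizer of `H`. -/
def rightTranslation (H : Subgroup G) (n : Subgroup.normalizer (H : Set G)) :
    G ⧸ H →[G] G ⧸ H where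
  toFun := Quotient.map' (fun g => g * (n : G)) (by
    intro a b hab
    rw [QuotientGroup.leftRel_apply] at hab ⊢
    have := (Subgroup.mem_normalizer_iff.1 (inv_mem n.2) (a⁻¹ * b)).1 hab
    simpa [mul_assoc] using this)
  map_smul' g x := by
    induction x using QuotientGroup.induction_on
    exact congrArg QuotientGroup.mk (mul_assoc g _ _)

/-- The normalizer of `H` acts on the `G`-maps `G ⧸ K → G ⧸ H`: composition with right
translations is a right action `f · n`, turned into the left action `n • f = f · n⁻¹`. -/
instance {𝓗 : ClassOfSubgroups G} (K H : Orb 𝓗) :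
    MulAction (Subgroup.normalizer (H.sub : Set G)) (K ⟶ H) where
  smul n f := f ≫ (rightTranslation H.sub n⁻¹ : H ⟶ H)
  one_smul f := by
    apply MulActionHom.ext
    intro x
    change rightTranslation H.sub 1⁻¹ (Orb.toMap f x) = Orb.toMap f x
    induction Orb.toMap f x using QuotientGroup.induction_on
    exact congrArg QuotientGroup.mk (by simp)
  mul_smul m n f := by
    apply MulActionHom.ext
    intro x
    change rightTranslation H.sub (m * n)⁻¹ (Orb.toMap f x) =
      rightTranslation H.sub m⁻¹ (rightTranslation H.sub n⁻¹ (Orb.toMap f x))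
    induction Orb.toMap f x using QuotientGroup.induction_on
    exact congrArg QuotientGroup.mk (by simp [mul_assoc])

/-- The induced action of `WH` on the `G`-maps `G ⧸ K → G ⧸ H`. -/
instance {𝓗 : ClassOfSubgroups G} (K H : Orb 𝓗) : MulAction (Weyl H.sub) (K ⟶ H) :=
  quotientMulAction _ (fun s hs f => by
    apply MulActionHom.ext
    intro x
    change rightTranslation H.sub s⁻¹ (Orb.toMap f x) = Orb.toMap f x
    induction Orb.toMap f x using QuotientGroup.induction_on
    refine QuotientGroup.eq.2 ?_
    simpa using Subgroup.mem_subgroupOf.1 hs)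

variable (R : Type u) [CommRing R]

/-- The category of Bredon contramodules for `𝓗` over `R`. -/
abbrev Contramodule (𝓗 : ClassOfSubgroups G) := (Orb 𝓗)ᵒᵖ ⥤ ModuleCat.{u} R

/-- The trivial contramodule: the constant functor with value `R`. -/
noncomputable abbrev trivialContramodule (𝓗 : ClassOfSubgroups G) : Contramodule R 𝓗 :=
  (Functor.const _).obj (ModuleCat.of R R)

/-- The free contramodule `P_H : K ↦ R⟨Map_G(G ⧸ K, G ⧸ H)⟩` based at `H`, with its action of
`WH` (see the action on `G`-maps above). -/
noncomputable def freeContramodule {𝓗 : ClassOfSubgroups G} (H : Orb 𝓗) :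
    (Orb 𝓗)ᵒᵖ ⥤ Rep.{u} R (Weyl H.sub) where
  obj K := Rep.of (permRep R (Weyl H.sub) (K.unop ⟶ H))
  map f := Rep.ofHom ⟨Finsupp.lmapDomain R R (f.unop ≫ ·), fun w => by
    refine Finsupp.lhom_ext' fun c => LinearMap.ext_ring ?_
    induction w using QuotientGroup.induction_on
    simp only [permRep, MonoidHom.coe_mk, OneHom.coe_mk, LinearMap.comp_apply,
      Finsupp.lsingle_apply, Finsupp.lmapDomain_apply, Finsupp.mapDomain_single]
    rfl⟩
  map_id K := by
    apply Rep.hom_ext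
    apply Representation.IntertwiningMap.ext
    refine Finsupp.lhom_ext' fun c => LinearMap.ext_ring ?_
    change Finsupp.lmapDomain R R _ (Finsupp.single c 1) = Finsupp.single c 1
    simp
  map_comp f g := by
    apply Rep.hom_ext
    apply Representation.IntertwiningMap.ext
    refine Finsupp.lhom_ext' fun c => LinearMap.ext_ring ?_
    change Finsupp.lmapDomain R R _ (Finsupp.single c 1) =
      Finsupp.lmapDomain R R _ (Finsupp.lmapDomain R R _ (Finsupp.single c 1))
    simp

/-- The induction functor `U ↦ P_H(-) ⊗_{WH} U` from `WH`-modules to Bredon contramodules. Here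
`A ⊗_W U` is the quotient of `A ⊗_R U` by the diagonal action `w a ⊗ w u ∼ a ⊗ u`, i.e. the
tensor product over `RW` of the right module `A` (with `a · w = w⁻¹ a`) and the left module
`U`. -/
noncomputable def ind {𝓗 : ClassOfSubgroups G} (H : Orb 𝓗) :
    Rep.{u} R (Weyl H.sub) ⥤ Contramodule R 𝓗 :=
  (Rep.coinvariantsTensor R (Weyl H.sub)).flip ⋙
    (Functor.whiskeringLeft _ _ _).obj (freeContramodule R H)

end Contramodules

/-- The component `f i ⟶ g j` of a morphism between coproducts. -/
noncomputable def component {C : Type*} [Category C] [HasZeroMorphisms C] {β : Type*}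
    {f g : β → C} [HasCoproduct f] [HasCoproduct g] (d : ∐ f ⟶ ∐ g) (i j : β) : f i ⟶ g j :=
  open Classical in Sigma.ι f i ≫ d ≫ Sigma.π g j

end Bredon

/-! At an orbit `G ⧸ L` consider the chains K₀ < ⋯ < K_n in 𝓗 with L ≤ K₀. Conjugation along maps of
orbits makes their chain complex a complex of contramodules. It resolves the trivial contramodule: L
is the least member of {K ∈ 𝓗 : L ≤ K}, so prepending L is a contraction
(`quasiIso_upperAugmentation`). Its terms need not be projective, and the rest of the proof replaces
it by a complex of projectives.

Filter by the length of K₀. Passing to a face never lowers this length, and omitting K₀ raises it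
strictly, so K₀ is frozen in the layer of length k. There K₀ is the conjugate of a representative H
along a map `G ⧸ L → G ⧸ H`, the other members form a chain in 𝓗_H, and the pair is unique up to WH.
The layer is therefore the sum of the complexes induced from the Σ𝓗̃_H with H of length k
(`isIso_gradedCoprodMap`). Since WH acts freely on the maps to `G ⧸ H`, induction is exact
(`preservesHomology_of_free`), and the P_H induce a resolution of the layer
(`quasiIso_desc_resolutionMap`). Its terms are projective because induction is left adjoint to
evaluation at H, which preserves epimorphisms (`projective_ind`).

The layers are glued by descending induction on k, starting above all lengths, where the filtration
vanishes. Let Q resolve the step F_{k+1}, and let A, projective in each degree, resolve the layer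
F_k / F_{k+1}. The map from A lifts, degree by degree, to a pair of a map v to F_k and a twist u :
A_{n+1} → Q_n (`exists_twisting`). The sum A ⊕ Q with differential twisted by u then maps to F_k,
and the five lemma shows that this is a quasi-isomorphism (`exists_twisted_quasiIso`). The only new
off-diagonal component, u, goes from length k to lengths greater than k; `FilteredModel` records
this through the induction. -/

namespace HomologicalComplex.HomologySequence

/-! ### The five lemma for homology -/

open ComposableArrows Abelian

variable {C ι : Type*} [Category* C] [Abelian C] {c : ComplexShape ι}
  {S₁ S₂ : ShortComplex (HomologicalComplex C c)} (φ : S₁ ⟶ S₂)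
  (hS₁ : S₁.ShortExact) (hS₂ : S₂.ShortExact)

include hS₁ hS₂

/-- The four lemma on the stretch of the long exact sequence from H_j of the third term to H_i of
the third term. If no `j` precedes `i`, there is no connecting map into degree `i`, and `S₂.f` is
already injective on H_i. -/
theorem mono_homologyMap_τ₂ (i : ι)
    (h₁ : Mono (homologyMap φ.τ₁ i)) (h₃ : Mono (homologyMap φ.τ₃ i))
    (h₃' : ∀ j, c.Rel j i → Epi (homologyMap φ.τ₃ j)) :
    Mono (homologyMap φ.τ₂ i) := by
  by_cases hi : ∃ j, c.Rel j i
  · obtain ⟨j, hij⟩ := hi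
    apply mono_of_epi_of_mono_of_mono
      ((δ₀Functor ⋙ δ₀Functor).map (mapComposableArrows₅ φ hS₁ hS₂ j i hij))
    · exact (composableArrows₅_exact hS₁ j i hij).δ₀.δ₀
    · exact (composableArrows₅_exact hS₂ j i hij).δ₀.δ₀
    · exact h₃' _ hij
    · exact h₁
    · exact h₃
  · refine mono_of_mono_of_mono_of_mono (mapComposableArrows₂ φ i)
      (composableArrows₂_exact hS₁ i) ?_ h₁ h₃
    have := hS₂.mono_f
    exact mono_homologyMap_of_mono_of_not_rel S₂.f i (by simpa using hi)

theorem epi_homologyMap_τ₂ (i : ι)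
    (h₁ : Epi (homologyMap φ.τ₁ i)) (h₃ : Epi (homologyMap φ.τ₃ i))
    (h₁' : ∀ j, c.Rel i j → Mono (homologyMap φ.τ₁ j)) :
    Epi (homologyMap φ.τ₂ i) := by
  by_cases hi : ∃ j, c.Rel i j
  · obtain ⟨j, hij⟩ := hi
    apply epi_of_epi_of_epi_of_mono
      ((δlastFunctor ⋙ δlastFunctor).map (mapComposableArrows₅ φ hS₁ hS₂ i j hij))
    · exact (composableArrows₅_exact hS₁ i j hij).δlast.δlast
    · exact (composableArrows₅_exact hS₂ i j hij).δlast.δlast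
    · exact h₁
    · exact h₃
    · exact h₁' _ hij
  · refine epi_of_epi_of_epi_of_epi (mapComposableArrows₂ φ i)
      (composableArrows₂_exact hS₂ i) ?_ h₁ h₃
    have := hS₁.epi_g
    exact epi_homologyMap_of_epi_of_not_rel S₁.g i (by simpa using hi)

theorem quasiIso_τ₂ (h₁ : QuasiIso φ.τ₁) (h₃ : QuasiIso φ.τ₃) : QuasiIso φ.τ₂ := by
  rw [quasiIso_iff]
  intro i
  rw [quasiIsoAt_iff_isIso_homologyMap]
  have := mono_homologyMap_τ₂ φ hS₁ hS₂ i inferInstance inferInstance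
    (fun _ _ => inferInstance)
  have := epi_homologyMap_τ₂ φ hS₁ hS₂ i inferInstance inferInstance
    (fun _ _ => inferInstance)
  apply isIso_of_mono_of_epi

end HomologicalComplex.HomologySequence

/-! ### Lifting complexes of projectives through an extension -/

namespace ChainComplex

open HomologicalComplex

variable {C : Type*} [Category* C] [Abelian C]

section ProjectiveElements

variable {F G : ChainComplex C ℕ} (φ : F ⟶ G) [QuasiIso φ] {T : C} [Projective T]

/-- On maps out of a projective object, a quasi-isomorphism detects boundaries. -/
theorem exists_comp_d_eq_of_quasiIso (n : ℕ) (x : T ⟶ F.X n)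
    (hx : ∀ j, x ≫ F.d n j = 0) (y : T ⟶ G.X (n + 1)) (hy : x ≫ φ.f n = y ≫ G.d (n + 1) n) :
    ∃ x' : T ⟶ F.X (n + 1), x' ≫ F.d (n + 1) n = x := by
  have hm : Mono (homologyMap φ n) := inferInstance
  rw [mono_homologyMap_iff_up_to_refinements φ (n + 1) n _ (by simp) rfl] at hm
  obtain ⟨T', π, _, x₁, h⟩ := hm x (hx _) y hy
  -- Exactness in an abelian category gives an element only after a cover `π` of `T`; the cover
  -- splits because `T` is projective.
  exact ⟨Projective.factorThru (𝟙 T) π ≫ x₁, by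
    rw [Category.assoc, ← h, Projective.factorThru_comp_assoc, Category.id_comp]⟩

/-- On maps out of a projective object, a quasi-isomorphism hits every homology class. -/
theorem exists_cycle_of_quasiIso (n : ℕ) (y : T ⟶ G.X n) (hy : ∀ j, y ≫ G.d n j = 0) :
    ∃ (x : T ⟶ F.X n) (y' : T ⟶ G.X (n + 1)), (∀ j, x ≫ F.d n j = 0) ∧
      y = x ≫ φ.f n + y' ≫ G.d (n + 1) n := by
  have hm : Epi (homologyMap φ n) := inferInstance
  rw [epi_homologyMap_iff_up_to_refinements φ (n + 1) n _ (by simp) rfl] at hm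
  obtain ⟨T', π, _, x₁, hx₁, y₁, h⟩ := hm y (hy _)
  refine ⟨Projective.factorThru (𝟙 T) π ≫ x₁, Projective.factorThru (𝟙 T) π ≫ y₁, ?_, ?_⟩
  · intro j
    by_cases hj : (ComplexShape.down ℕ).next n = j
    · subst hj
      rw [Category.assoc, hx₁, comp_zero]
    · rw [F.shape, comp_zero]
      intro h'
      exact hj (ComplexShape.next_eq' _ h')
  · rw [Category.assoc, Category.assoc, ← Preadditive.comp_add, ← h,
      Projective.factorThru_comp_assoc, Category.id_comp]

/-- On maps out of a projective object, the mapping cone of a quasi-isomorphism is exact. -/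
theorem exists_cone_boundary_of_quasiIso (n : ℕ) (x : T ⟶ F.X n)
    (hx : ∀ j, x ≫ F.d n j = 0) (y : T ⟶ G.X (n + 1)) (hy : x ≫ φ.f n = y ≫ G.d (n + 1) n) :
    ∃ (x' : T ⟶ F.X (n + 1)) (y' : T ⟶ G.X (n + 2)), x' ≫ F.d (n + 1) n = x ∧
      y = x' ≫ φ.f (n + 1) + y' ≫ G.d (n + 2) (n + 1) := by
  obtain ⟨x₁, hx₁⟩ := exists_comp_d_eq_of_quasiIso φ n x hx y hy
  -- The first choice `x₁` bounds `x` but ignores `y`. The discrepancy `y - φ x₁` is a cycle, so it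
  -- comes from a cycle `z` up to a boundary, and adding `z` does not change the boundary of `x₁`.
  obtain ⟨z, y', hz, h⟩ := exists_cycle_of_quasiIso φ (n + 1) (y - x₁ ≫ φ.f (n + 1)) (by
    intro j
    by_cases hj : j = n
    · subst hj
      rw [Preadditive.sub_comp, Category.assoc, φ.comm, ← Category.assoc, hx₁, hy, sub_self]
    · rw [G.shape, comp_zero]
      simp; omega)
  refine ⟨x₁ + z, y', by simp [hx₁, hz], ?_⟩
  rw [Preadditive.add_comp, add_assoc, ← h]
  abel

end ProjectiveElements

section Extension

variable {S : ShortComplex (ChainComplex C ℕ)} (hS : S.ShortExact) {Q A : ChainComplex C ℕ}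
  (φ : Q ⟶ S.X₁) [QuasiIso φ] (ε : A ⟶ S.X₃) [∀ n, Projective (A.X n)]

include hS in
theorem exists_lift_to_fst (n : ℕ) {T : C} (y : T ⟶ S.X₂.X n) (hy : y ≫ S.g.f n = 0) :
    ∃ x : T ⟶ S.X₁.X n, x ≫ S.f.f n = y := by
  have h : (S.map (eval C _ n)).ShortExact := hS.map_of_exact _
  have := h.mono_f
  exact ⟨h.exact.lift y hy, h.exact.lift_f _ _⟩

/-- A stage of the construction of a twisting cochain in `exists_twisting`. -/
structure TwistingStage (n : ℕ) where
  u : A.X (n + 1) ⟶ Q.X n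
  v : A.X (n + 1) ⟶ S.X₂.X (n + 1)
  hv : v ≫ S.g.f (n + 1) = ε.f (n + 1)
  -- `hu` and `huv` are what survives of the equations with the preceding stage after composing with
  -- `A.d`. A stage thus does not mention its predecessor, and plain recursion applies.
  hu : ∀ j, A.d (n + 2) (n + 1) ≫ u ≫ Q.d n j = 0
  huv : A.d (n + 2) (n + 1) ≫ v ≫ S.X₂.d (n + 1) n =
    A.d (n + 2) (n + 1) ≫ u ≫ φ.f n ≫ S.f.f n

include hS in
-- Any lift `v₀` of `ε` fails to fit with `s.v` by a map `c` into `S.X₁`. The pair formed by `A.d ≫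
-- s.u` and `c` is a cycle in the cone of `φ`, hence bounds some `(x', y')` because `A` is
-- projective; the corrections are `-x'` for `u` and `y'` for `v`.
theorem TwistingStage.exists_next {n : ℕ} (s : TwistingStage φ ε n) :
    ∃ s' : TwistingStage φ ε (n + 1),
      A.d (n + 2) (n + 1) ≫ s.u + s'.u ≫ Q.d (n + 1) n = 0 ∧
      A.d (n + 2) (n + 1) ≫ s.v + s'.u ≫ φ.f (n + 1) ≫ S.f.f (n + 1) =
        s'.v ≫ S.X₂.d (n + 2) (n + 1) := by
  have hmono : Mono (S.f.f n) := (hS.map_of_exact (eval C _ n)).mono_f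
  have hepi : Epi (S.g.f (n + 2)) := (hS.map_of_exact (eval C _ (n + 2))).epi_g
  let v₀ := Projective.factorThru (ε.f (n + 2)) (S.g.f (n + 2))
  have hv₀ : v₀ ≫ S.g.f (n + 2) = ε.f (n + 2) := Projective.factorThru_comp _ _
  obtain ⟨c, hc⟩ := exists_lift_to_fst hS (n + 1)
    (A.d (n + 2) (n + 1) ≫ s.v - v₀ ≫ S.X₂.d (n + 2) (n + 1)) (by
      rw [Preadditive.sub_comp, Category.assoc, Category.assoc, s.hv, ← S.g.comm,
        ← Category.assoc v₀, hv₀, ε.comm, sub_self])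
  obtain ⟨x', y', hx', hy'⟩ := exists_cone_boundary_of_quasiIso φ n (A.d (n + 2) (n + 1) ≫ s.u)
    (by simpa using s.hu) c (by
      rw [← cancel_mono (S.f.f n), Category.assoc, Category.assoc, Category.assoc, ← s.huv,
        ← S.f.comm, ← Category.assoc c, hc]
      simp)
  have e : A.d (n + 2) (n + 1) ≫ s.v + (-x') ≫ φ.f (n + 1) ≫ S.f.f (n + 1) =
      (v₀ + y' ≫ S.f.f (n + 2)) ≫ S.X₂.d (n + 2) (n + 1) := by
    have h := congrArg (· ≫ S.f.f (n + 1)) hy'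
    simp only [hc, Preadditive.add_comp, Category.assoc] at h
    rw [sub_eq_iff_eq_add] at h
    rw [h]
    simp only [Preadditive.neg_comp, Preadditive.add_comp, Category.assoc, S.f.comm]
    abel
  refine ⟨⟨-x', v₀ + y' ≫ S.f.f (n + 2), ?_, ?_, ?_⟩, ?_, e⟩
  · have : S.f.f (n + 2) ≫ S.g.f (n + 2) = 0 := by
      rw [← HomologicalComplex.comp_f, S.zero, HomologicalComplex.zero_f]
    simp [hv₀, this]
  · intro j
    by_cases hj : j = n
    · subst hj
      simp [hx']
    · rw [Q.shape, comp_zero, comp_zero]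
      simp; omega
  · rw [← e]
    simp
  · simp [hx']

include hS in
theorem exists_twistingStage_zero :
    -- In degree 0 every map is a cycle, so surjectivity of `φ` on H₀ already absorbs the defect
    -- `c`.
    ∃ (v : A.X 0 ⟶ S.X₂.X 0) (s : TwistingStage φ ε 0), v ≫ S.g.f 0 = ε.f 0 ∧
      A.d 1 0 ≫ v + s.u ≫ φ.f 0 ≫ S.f.f 0 = s.v ≫ S.X₂.d 1 0 := by
  have hepi (n) : Epi (S.g.f n) := (hS.map_of_exact (eval C _ n)).epi_g
  let v := Projective.factorThru (ε.f 0) (S.g.f 0)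
  have hv : v ≫ S.g.f 0 = ε.f 0 := Projective.factorThru_comp _ _
  let v₀ := Projective.factorThru (ε.f 1) (S.g.f 1)
  have hv₀ : v₀ ≫ S.g.f 1 = ε.f 1 := Projective.factorThru_comp _ _
  obtain ⟨c, hc⟩ := exists_lift_to_fst hS 0
    (A.d 1 0 ≫ v - v₀ ≫ S.X₂.d 1 0) (by
      rw [Preadditive.sub_comp, Category.assoc, Category.assoc, hv, ← S.g.comm,
        ← Category.assoc v₀, hv₀, ε.comm, sub_self])
  obtain ⟨x', y', -, hy'⟩ := exists_cycle_of_quasiIso φ 0 c (by simp)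
  have e : A.d 1 0 ≫ v + (-x') ≫ φ.f 0 ≫ S.f.f 0 =
      (v₀ + y' ≫ S.f.f 1) ≫ S.X₂.d 1 0 := by
    have h := congrArg (· ≫ S.f.f 0) hy'
    simp only [hc, Preadditive.add_comp, Category.assoc] at h
    rw [sub_eq_iff_eq_add] at h
    rw [h]
    simp only [Preadditive.neg_comp, Preadditive.add_comp, Category.assoc, S.f.comm]
    abel
  refine ⟨v, ⟨-x', v₀ + y' ≫ S.f.f 1, ?_, ?_, ?_⟩, hv, e⟩
  · have : S.f.f 1 ≫ S.g.f 1 = 0 := by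
      rw [← HomologicalComplex.comp_f, S.zero, HomologicalComplex.zero_f]
    simp [hv₀, this]
  · simp
  · rw [← e]
    simp

include hS in
/-- A chain map `ε` from a complex of projectives to the cokernel of a monomorphism of complexes
lifts to the mapping cone of the monomorphism precomposed with a quasi-isomorphism. -/
theorem exists_twisting :
    ∃ (u : ∀ n, A.X (n + 1) ⟶ Q.X n) (v : ∀ n, A.X n ⟶ S.X₂.X n),
      (∀ n, A.d (n + 2) (n + 1) ≫ u n + u (n + 1) ≫ Q.d (n + 1) n = 0) ∧
      (∀ n, A.d (n + 1) n ≫ v n + u n ≫ φ.f n ≫ S.f.f n = v (n + 1) ≫ S.X₂.d (n + 1) n) ∧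
      ∀ n, v n ≫ S.g.f n = ε.f n := by
  obtain ⟨v, s, hv, hs⟩ := exists_twistingStage_zero hS φ ε
  choose next h₁ h₂ using fun n => TwistingStage.exists_next (n := n) hS φ ε
  let t : ∀ n, TwistingStage φ ε n := fun n => Nat.rec s (fun n s => next n s) n
  -- Stage `n` carries the component of `v` in degree `n + 1`; degree 0 is supplied separately.
  refine ⟨fun n => (t n).u, fun n => Nat.casesOn n v (fun n => (t n).v), fun n => h₁ n (t n), ?_, ?_⟩
  · rintro (_ | n)
    · exact hs
    · exact h₂ n (t n)
  · rintro (_ | n)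
    · exact hv
    · exact (t n).hv

variable {φ ε}

end Extension

end ChainComplex

/-! ### Twisted extensions -/

namespace ChainComplex

open HomologicalComplex

variable {C : Type*} [Category* C] [Abelian C]

/-- A chain map is determined by its components, compatible with `d (n + 1) n`. -/
@[simps]
def homMk {K L : ChainComplex C ℕ} (f : ∀ n, K.X n ⟶ L.X n)
    (h : ∀ n, f (n + 1) ≫ L.d (n + 1) n = K.d (n + 1) n ≫ f n) : K ⟶ L where
  f := f
  comm' i j hij := by
    obtain rfl : j + 1 = i := hij
    exact h j

section Twisted

variable {Q A : ChainComplex C ℕ} (u : ∀ n, A.X (n + 1) ⟶ Q.X n)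
  (hu : ∀ n, A.d (n + 2) (n + 1) ≫ u n + u (n + 1) ≫ Q.d (n + 1) n = 0)

/-- The extension of `A` by `Q` twisted by `u`. -/
noncomputable def twisted : ChainComplex C ℕ :=
  ChainComplex.of (fun n => A.X n ⊞ Q.X n)
    -- This is a mapping cone: `hu` says that `u` is, up to the sign of the shift, a chain map from
    -- the desuspension of `A` to `Q`. It is also the only nontrivial part of d² = 0.
    (fun n => biprod.desc (biprod.lift (A.d (n + 1) n) (u n)) (biprod.lift 0 (Q.d (n + 1) n)))
    (fun n => by
      ext
      · simp
      · simp only [biprod.inl_desc_assoc, biprod.lift_desc, Preadditive.add_comp, Category.assoc,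
          biprod.lift_snd, zero_comp, comp_zero]
        exact hu n
      · simp
      · simp)

namespace twisted

/-- The inclusion of `A` in a twisted extension, in degree `n`. -/
noncomputable def inl (n : ℕ) : A.X n ⟶ (twisted u hu).X n :=
  (biprod.inl : A.X n ⟶ A.X n ⊞ Q.X n)

/-- The inclusion of `Q` in a twisted extension, in degree `n`. -/
noncomputable def inr (n : ℕ) : Q.X n ⟶ (twisted u hu).X n :=
  (biprod.inr : Q.X n ⟶ A.X n ⊞ Q.X n)

/-- The projection of a twisted extension to `A`, in degree `n`. -/
noncomputable def fst (n : ℕ) : (twisted u hu).X n ⟶ A.X n :=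
  (biprod.fst : A.X n ⊞ Q.X n ⟶ A.X n)

/-- The projection of a twisted extension to `Q`, in degree `n`. -/
noncomputable def snd (n : ℕ) : (twisted u hu).X n ⟶ Q.X n :=
  (biprod.snd : A.X n ⊞ Q.X n ⟶ Q.X n)

/-- A morphism out of a twisted extension, in degree `n`. -/
noncomputable def desc {Z : C} {n : ℕ} (f : A.X n ⟶ Z) (g : Q.X n ⟶ Z) :
    (twisted u hu).X n ⟶ Z :=
  (biprod.desc f g : A.X n ⊞ Q.X n ⟶ Z)

@[simp]
theorem inl_fst (n : ℕ) : inl u hu n ≫ fst u hu n = 𝟙 _ := biprod.inl_fst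

@[simp]
theorem inl_fst_assoc {Z : C} (n : ℕ) (h : A.X n ⟶ Z) :
    inl u hu n ≫ fst u hu n ≫ h = h := biprod.inl_fst_assoc h

@[simp]
theorem inr_fst (n : ℕ) : inr u hu n ≫ fst u hu n = 0 := biprod.inr_fst

@[simp]
theorem inr_fst_assoc {Z : C} (n : ℕ) (h : A.X n ⟶ Z) :
    inr u hu n ≫ fst u hu n ≫ h = 0 := (biprod.inr_fst_assoc h).trans zero_comp

@[simp]
theorem inr_snd (n : ℕ) : inr u hu n ≫ snd u hu n = 𝟙 _ := biprod.inr_snd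

@[simp]
theorem inl_desc {Z : C} {n : ℕ} (f : A.X n ⟶ Z) (g : Q.X n ⟶ Z) :
    inl u hu n ≫ desc u hu f g = f := biprod.inl_desc f g

@[simp]
theorem inl_desc_assoc {Z Z' : C} {n : ℕ} (f : A.X n ⟶ Z) (g : Q.X n ⟶ Z) (h : Z ⟶ Z') :
    inl u hu n ≫ desc u hu f g ≫ h = f ≫ h := biprod.inl_desc_assoc f g h

@[simp]
theorem inr_desc {Z : C} {n : ℕ} (f : A.X n ⟶ Z) (g : Q.X n ⟶ Z) :
    inr u hu n ≫ desc u hu f g = g := biprod.inr_desc f g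

@[simp]
theorem inr_desc_assoc {Z Z' : C} {n : ℕ} (f : A.X n ⟶ Z) (g : Q.X n ⟶ Z) (h : Z ⟶ Z') :
    inr u hu n ≫ desc u hu f g ≫ h = g ≫ h := biprod.inr_desc_assoc f g h

theorem total (n : ℕ) : fst u hu n ≫ inl u hu n + snd u hu n ≫ inr u hu n = 𝟙 _ :=
  biprod.total

variable {u hu} in
theorem hom_ext {Z : C} {n : ℕ} {f g : (twisted u hu).X n ⟶ Z}
    (h₁ : inl u hu n ≫ f = inl u hu n ≫ g) (h₂ : inr u hu n ≫ f = inr u hu n ≫ g) : f = g :=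
  biprod.hom_ext' _ _ h₁ h₂

theorem d_eq (n : ℕ) : (twisted u hu).d (n + 1) n =
    (biprod.desc (biprod.lift (A.d (n + 1) n) (u n)) (biprod.lift 0 (Q.d (n + 1) n)) :
      A.X (n + 1) ⊞ Q.X (n + 1) ⟶ A.X n ⊞ Q.X n) :=
  ChainComplex.of_d (fun n => A.X n ⊞ Q.X n)
    (fun n => biprod.desc (biprod.lift (A.d (n + 1) n) (u n)) (biprod.lift 0 (Q.d (n + 1) n))) n

@[simp]
theorem inl_d (n : ℕ) : inl u hu (n + 1) ≫ (twisted u hu).d (n + 1) n =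
    A.d (n + 1) n ≫ inl u hu n + u n ≫ inr u hu n := by
  rw [d_eq]
  refine (biprod.inl_desc _ _).trans ?_
  exact biprod.lift_eq

@[simp]
theorem inr_d (n : ℕ) : inr u hu (n + 1) ≫ (twisted u hu).d (n + 1) n =
    Q.d (n + 1) n ≫ inr u hu n := by
  rw [d_eq]
  refine (biprod.inr_desc _ _).trans ?_
  refine biprod.lift_eq.trans ?_
  rw [zero_comp, zero_add]
  rfl

@[simp]
theorem inl_d_assoc {Z : C} (n : ℕ) (h : (twisted u hu).X n ⟶ Z) :
    inl u hu (n + 1) ≫ (twisted u hu).d (n + 1) n ≫ h =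
      A.d (n + 1) n ≫ inl u hu n ≫ h + u n ≫ inr u hu n ≫ h := by
  rw [← Category.assoc, inl_d, Preadditive.add_comp, Category.assoc, Category.assoc]

@[simp]
theorem inr_d_assoc {Z : C} (n : ℕ) (h : (twisted u hu).X n ⟶ Z) :
    inr u hu (n + 1) ≫ (twisted u hu).d (n + 1) n ≫ h = Q.d (n + 1) n ≫ inr u hu n ≫ h := by
  rw [← Category.assoc, inr_d, Category.assoc]

end twisted

/-- The short exact sequence of a twisted extension. -/
noncomputable def twistedShortComplex : ShortComplex (ChainComplex C ℕ) where
  X₁ := Q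
  X₂ := twisted u hu
  X₃ := A
  f := homMk (twisted.inr u hu) (by simp)
  g := homMk (twisted.fst u hu) (fun n => by apply twisted.hom_ext <;> simp)
  zero := by
    ext n
    simp

theorem twistedShortComplex_shortExact : (twistedShortComplex u hu).ShortExact := by
  refine HomologicalComplex.shortExact_of_degreewise_shortExact _ fun n => ?_
  exact ShortComplex.Splitting.shortExact
    { r := twisted.snd u hu n
      s := twisted.inl u hu n
      f_r := twisted.inr_snd u hu n
      s_g := twisted.inl_fst u hu n
      id := (add_comm _ _).trans (twisted.total u hu n) }

/-- If `φ : Q ⟶ S.X₁` and `ε : A ⟶ S.X₃` are quasi-isomorphisms to the ends of a short exact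
sequence and `A` is degreewise projective, then some twisted extension of `A` by `Q` is
quasi-isomorphic to the middle term. -/
theorem exists_twisted_quasiIso {S : ShortComplex (ChainComplex C ℕ)} (hS : S.ShortExact)
    {Q A : ChainComplex C ℕ} (φ : Q ⟶ S.X₁) [QuasiIso φ] (ε : A ⟶ S.X₃) [QuasiIso ε]
    [∀ n, Projective (A.X n)] :
    ∃ (u : ∀ n, A.X (n + 1) ⟶ Q.X n)
      (hu : ∀ n, A.d (n + 2) (n + 1) ≫ u n + u (n + 1) ≫ Q.d (n + 1) n = 0)
      (g : twisted u hu ⟶ S.X₂), QuasiIso g := by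
  obtain ⟨u, v, hu, huv, hv⟩ := exists_twisting hS φ ε
  let g : twisted u hu ⟶ S.X₂ :=
    homMk (fun n => twisted.desc u hu (v n) (φ.f n ≫ S.f.f n))
      (fun n => by
        apply twisted.hom_ext
        · simp [huv]
        · simp)
  -- A map of short exact sequences with outer terms `φ` and `ε`, to which the five lemma applies.
  let ψ : twistedShortComplex u hu ⟶ S :=
    { τ₁ := φ
      τ₂ := g
      τ₃ := ε
      comm₁₂ := by
        apply HomologicalComplex.hom_ext
        intro n
        exact (twisted.inr_desc u hu (v n) (φ.f n ≫ S.f.f n)).symm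
      comm₂₃ := by
        apply HomologicalComplex.hom_ext
        intro n
        have : S.f.f n ≫ S.g.f n = 0 := by
          rw [← HomologicalComplex.comp_f, S.zero, HomologicalComplex.zero_f]
        change twisted.desc u hu _ _ ≫ S.g.f n = twisted.fst u hu n ≫ ε.f n
        apply twisted.hom_ext <;> simp [hv, this] }
  exact ⟨u, hu, g, HomologySequence.quasiIso_τ₂ ψ (twistedShortComplex_shortExact u hu) hS
    (by assumption) (by assumption)⟩

end Twisted

/-! ### Degreewise coproducts of complexes -/

section Coproduct

variable {J : Type u} [HasColimitsOfShape (Discrete J) C]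

/-- A family of chain complexes as a chain complex of families. -/
noncomputable def familyComplex (X : J → ChainComplex C ℕ) : ChainComplex (Discrete J ⥤ C) ℕ where
  X n := Discrete.functor fun j => (X j).X n
  d m n := Discrete.natTrans fun j => (X j.as).d m n
  shape m n h := by
    ext j
    exact (X j.as).shape m n h
  d_comp_d' l m n _ _ := by
    ext j
    exact (X j.as).d_comp_d l m n

/-- The coproduct of a family of chain complexes, formed degreewise. -/
noncomputable def coprod (X : J → ChainComplex C ℕ) : ChainComplex C ℕ :=
  ((colim (J := Discrete J) (C := C)).mapHomologicalComplex _).obj (familyComplex X)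

namespace coprod

variable (X : J → ChainComplex C ℕ)

/-- The inclusions in the degreewise coproduct. -/
noncomputable def ι (j : J) : X j ⟶ coprod X where
  f n := colimit.ι ((familyComplex X).X n) ⟨j⟩
  comm' m n _ := ι_colimMap ((familyComplex X).d m n) ⟨j⟩

variable {X}

theorem hom_ext {Z : C} {n : ℕ} {f g : (coprod X).X n ⟶ Z}
    (h : ∀ j, (ι X j).f n ≫ f = (ι X j).f n ≫ g) : f = g :=
  colimit.hom_ext fun j => h j.as

/-- Morphisms out of the coproduct in degree `n`. -/
noncomputable def descX {Z : C} {n : ℕ} (f : ∀ j, (X j).X n ⟶ Z) : (coprod X).X n ⟶ Z :=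
  colimit.desc ((familyComplex X).X n) (Cofan.mk Z f)

@[simp]
theorem ι_descX {Z : C} {n : ℕ} (f : ∀ j, (X j).X n ⟶ Z) (j : J) :
    (ι X j).f n ≫ descX f = f j :=
  colimit.ι_desc (Cofan.mk Z f) ⟨j⟩

@[simp]
theorem ι_descX_assoc {Z Z' : C} {n : ℕ} (f : ∀ j, (X j).X n ⟶ Z) (j : J) (h : Z ⟶ Z') :
    (ι X j).f n ≫ descX f ≫ h = f j ≫ h := by
  rw [← Category.assoc, ι_descX]

/-- Chain maps out of the degreewise coproduct. -/
noncomputable def desc {Y : ChainComplex C ℕ} (f : ∀ j, X j ⟶ Y) : coprod X ⟶ Y where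
  f n := descX fun j => (f j).f n
  comm' m n h := by
    refine hom_ext fun j => ?_
    rw [ι_descX_assoc, (ι X j).comm_assoc, ι_descX, (f j).comm]

/-- The map between coproducts induced by a family of chain maps. -/
noncomputable def map {X Y : J → ChainComplex C ℕ} (f : ∀ j, X j ⟶ Y j) :
    coprod X ⟶ coprod Y :=
  ((colim (J := Discrete J) (C := C)).mapHomologicalComplex _).map
    { f := fun n => Discrete.natTrans fun j => (f j.as).f n
      comm' := fun m n _ => by
        ext j
        exact (f j.as).comm m n }

@[simp]
theorem ι_map_f {X Y : J → ChainComplex C ℕ} (f : ∀ j, X j ⟶ Y j) (j : J) (n : ℕ) :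
    (ι X j).f n ≫ (map f).f n = (f j).f n ≫ (ι Y j).f n :=
  ι_colimMap (G := (familyComplex X).X n) (F := (familyComplex Y).X n)
    (Discrete.natTrans fun j => (f j.as).f n) ⟨j⟩

/-- Exact coproducts commute with homology, and a map of complexes of families is a
quasi-isomorphism as soon as each member is. -/
instance quasiIso_map [HasExactColimitsOfShape (Discrete J) C] {X Y : J → ChainComplex C ℕ}
    (f : ∀ j, X j ⟶ Y j) [∀ j, QuasiIso (f j)] : QuasiIso (map f) := by
  have := HasExactColimitsOfShape.preservesFiniteLimits (J := Discrete J) (C := C)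
  refine quasiIso_map_of_preservesHomology _ _ (hφ := ?_)
  rw [quasiIso_iff_evaluation]
  rintro ⟨j⟩
  exact inferInstanceAs (QuasiIso (f j))

theorem projective_X (n : ℕ) (hX : ∀ j, Projective ((X j).X n)) : Projective ((coprod X).X n) where
  factors f e _ :=
    ⟨descX fun j => Projective.factorThru ((ι X j).f n ≫ f) e, hom_ext fun j => by
      rw [ι_descX_assoc, Projective.factorThru_comp]⟩

end coprod

end Coproduct

end ChainComplex

/-! ### Gluing along a finite filtration -/

namespace ChainComplex

open HomologicalComplex

variable {C : Type*} [Category* C] [Abelian C]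

namespace coprod

variable {J : Type u} [HasColimitsOfShape (Discrete J) C] (X : J → ChainComplex C ℕ)

open Classical in
/-- The projections of the coproduct in degree `n`. -/
noncomputable def π (n : ℕ) (j : J) : (coprod X).X n ⟶ (X j).X n :=
  descX fun j' => if e : j' = j then eqToHom (by rw [e]) else 0

theorem ι_π_self (n : ℕ) (j : J) : (ι X j).f n ≫ π X n j = 𝟙 _ := by
  simp [π]

theorem ι_π_of_ne (n : ℕ) {j j' : J} (h : j ≠ j') : (ι X j).f n ≫ π X n j' = 0 := by
  simp [π, h]

end coprod

section Filtered

variable {J : Type u} (r : J → ℕ) (A : J → ChainComplex C ℕ)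

/-- A chain complex with underlying graded object the coproduct of the `A j` with `k ≤ r j`,
whose differential has diagonal components those of the `A j` and strictly raises `r`
off the diagonal. -/
structure FilteredModel (k : ℕ) where
  Q : ChainComplex C ℕ
  i : ∀ n j, (A j).X n ⟶ Q.X n
  π : ∀ n j, Q.X n ⟶ (A j).X n
  i_π_self : ∀ n j, k ≤ r j → i n j ≫ π n j = 𝟙 _
  i_π_of_ne : ∀ n j j', j ≠ j' → i n j ≫ π n j' = 0
  -- Structure maps are kept for every `j`, and are zero for those not yet attached, so the index
  -- type stays the same as `k` decreases.
  i_eq_zero : ∀ n j, r j < k → i n j = 0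
  π_eq_zero : ∀ n j, r j < k → π n j = 0
  existsUnique_desc : ∀ (n : ℕ) (Z : C) (f : ∀ j, (A j).X n ⟶ Z), (∀ j, r j < k → f j = 0) →
    ∃! h : Q.X n ⟶ Z, ∀ j, i n j ≫ h = f j
  i_d_π_self : ∀ n j, k ≤ r j → i (n + 1) j ≫ Q.d (n + 1) n ≫ π n j = (A j).d (n + 1) n
  i_d_π_of_ne : ∀ n j j', j ≠ j' → r j' ≤ r j → i (n + 1) j ≫ Q.d (n + 1) n ≫ π n j' = 0

variable {r A}

/-- The empty model. -/
noncomputable def FilteredModel.zero {k : ℕ} (hk : ∀ j, r j < k) : FilteredModel r A k where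
  Q := HomologicalComplex.zero
  i _ _ := 0
  π _ _ := 0
  i_π_self n j h := absurd h (hk j).not_ge
  i_π_of_ne := by simp
  i_eq_zero _ _ _ := rfl
  π_eq_zero _ _ _ := rfl
  existsUnique_desc n Z f hf :=
    ⟨0, fun j => by rw [hf j (hk j), comp_zero], fun h _ =>
      ((HomologicalComplex.eval C (ComplexShape.down ℕ) n).map_isZero
        HomologicalComplex.isZero_zero).eq_of_src _ _⟩
  i_d_π_self n j h := absurd h (hk j).not_ge
  i_d_π_of_ne := by simp

section Step

variable {k : ℕ} [HasColimitsOfShape (Discrete {j // r j = k}) C] (M : FilteredModel r A (k + 1))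
  (u : ∀ n, (coprod fun j : {j // r j = k} => A j).X (n + 1) ⟶ M.Q.X n)
  (hu : ∀ n, (coprod fun j : {j // r j = k} => A j).d (n + 2) (n + 1) ≫ u n +
    u (n + 1) ≫ M.Q.d (n + 1) n = 0)

open Classical in
/-- The inclusions for `FilteredModel.extend`. -/
noncomputable def FilteredModel.extendι (n : ℕ) (j : J) : (A j).X n ⟶ (twisted u hu).X n :=
  if h : r j = k then (coprod.ι (fun j : {j // r j = k} => A j) ⟨j, h⟩).f n ≫ twisted.inl u hu n
  else M.i n j ≫ twisted.inr u hu n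

open Classical in
/-- The projections for `FilteredModel.extend`. -/
noncomputable def FilteredModel.extendπ (n : ℕ) (j : J) : (twisted u hu).X n ⟶ (A j).X n :=
  twisted.desc u hu
    (if h : r j = k then coprod.π (fun j : {j // r j = k} => A j) n ⟨j, h⟩ else 0) (M.π n j)

/-- A twisted extension of the coproduct of the `A j` with `r j = k` by a model for `k + 1` is
a model for `k`. -/
noncomputable def FilteredModel.extend : FilteredModel r A k where
  Q := twisted u hu
  i := M.extendι u hu
  π := M.extendπ u hu
  i_π_self n j h := by
    by_cases hj : r j = k
    · simp [extendι, extendπ, hj, coprod.ι_π_self (fun j : {j // r j = k} => A j) n ⟨j, hj⟩]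
    · simp [extendι, extendπ, hj, M.i_π_self n j (by omega)]
  i_π_of_ne n j j' h := by
    by_cases hj : r j = k
    · by_cases hj' : r j' = k
      · simpa [extendι, extendπ, hj, hj'] using
          coprod.ι_π_of_ne (fun j : {j // r j = k} => A j) n
          (j := ⟨j, hj⟩) (j' := ⟨j', hj'⟩) (by simpa using h)
      · simp [extendι, extendπ, hj, hj']
    · simp [extendι, extendπ, hj, M.i_π_of_ne n j j' h]
  i_eq_zero n j h := by
    simp [extendι, h.ne, M.i_eq_zero n j (by omega)]
  π_eq_zero n j h := by
    apply twisted.hom_ext <;> simp [extendπ, h.ne, M.π_eq_zero n j (by omega)]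
  existsUnique_desc n Z f hf := by
    obtain ⟨h, hh, hh'⟩ := M.existsUnique_desc n Z (fun j => if r j = k then 0 else f j)
      (fun j hj => by
        by_cases hj' : r j = k
        · simp [hj']
        · simp [hj', hf j (by omega)])
    refine ⟨twisted.desc u hu (coprod.descX fun j => f j) h, fun j => ?_, fun h' hh₁ => ?_⟩
    · by_cases hj : r j = k
      · simp only [extendι, hj, dite_true, Category.assoc, twisted.inl_desc]
        exact coprod.ι_descX (X := fun j : {j // r j = k} => A j) (fun j => f j) ⟨j, hj⟩
      · simp [extendι, hj, hh j]
    · apply twisted.hom_ext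
      · refine coprod.hom_ext fun j => ?_
        have := hh₁ j
        simp only [extendι, j.2, dite_true, Category.assoc] at this
        rw [this, twisted.inl_desc, coprod.ι_descX]
      · rw [twisted.inr_desc]
        refine hh' _ fun j => ?_
        by_cases hj : r j = k
        · simp [hj, M.i_eq_zero n j (by omega)]
        · have := hh₁ j
          simp only [extendι, hj, dite_false, Category.assoc] at this
          simp [hj, this]
  i_d_π_self n j h := by
    by_cases hj : r j = k
    · have := coprod.ι_π_self (fun j : {j // r j = k} => A j) n ⟨j, hj⟩
      have h' := (coprod.ι (fun j : {j // r j = k} => A j) ⟨j, hj⟩).comm (n + 1) n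
      simp only [extendι, extendπ, hj, dite_true, Category.assoc, twisted.inl_d_assoc,
        twisted.inl_desc, twisted.inr_desc, M.π_eq_zero n j (by omega), comp_zero, add_zero]
      rw [← Category.assoc, h', Category.assoc, this, Category.comp_id]
    · simp [extendι, extendπ, hj, M.i_d_π_self n j (by omega)]
  i_d_π_of_ne n j j' h hr := by
    by_cases hj : r j = k
    -- The twist `u` lands in `M.Q`, which contains only ranks above `k`. Since `r j' ≤ r j = k`,
    -- the projection `M.π n j'` kills its contribution.
    · have h' := (coprod.ι (fun j : {j // r j = k} => A j) ⟨j, hj⟩).comm (n + 1) n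
      simp only [extendι, extendπ, hj, dite_true, Category.assoc, twisted.inl_d_assoc,
        twisted.inl_desc, twisted.inr_desc, M.π_eq_zero n j' (by omega), comp_zero, add_zero]
      by_cases hj' : r j' = k
      · have := coprod.ι_π_of_ne (fun j : {j // r j = k} => A j) n
          (j := ⟨j, hj⟩) (j' := ⟨j', hj'⟩) (by simpa using h)
        simp only [hj', dite_true]
        rw [← Category.assoc, h', Category.assoc, this, comp_zero]
      · simp [hj']
    · simp [extendι, extendπ, hj, M.i_d_π_of_ne n j j' h hr]

end Step

/-- For `k = 0` no summand is missing, so `existsUnique_desc` is the universal property of the full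
coproduct. The projections correspond because they agree on all inclusions. -/
theorem FilteredModel.exists_iso [HasCoproducts.{u} C] (M : FilteredModel r A 0) :
    ∃ e : ∀ n, M.Q.X n ≅ ∐ fun j => (A j).X n, ∀ n i j,
      Bredon.component ((e (n + 1)).inv ≫ M.Q.d (n + 1) n ≫ (e n).hom) i j =
        M.i (n + 1) i ≫ M.Q.d (n + 1) n ≫ M.π n j := by
  classical
  have h (n : ℕ) : ∃ e : M.Q.X n ≅ ∐ fun j => (A j).X n,
      ∀ j, M.i n j ≫ e.hom = Sigma.ι (fun j => (A j).X n) j := by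
    obtain ⟨h, hh, -⟩ := M.existsUnique_desc n _ (Sigma.ι fun j => (A j).X n) (by simp)
    refine ⟨⟨h, Sigma.desc (M.i n), ?_, ?_⟩, hh⟩
    · obtain ⟨_, -, h₂⟩ := M.existsUnique_desc n _ (M.i n) (by simp)
      rw [h₂ (𝟙 _) (by simp), h₂ (h ≫ Sigma.desc (M.i n)) fun j => by
        rw [← Category.assoc, hh, Sigma.ι_desc]]
    · refine Sigma.hom_ext _ _ fun j => ?_
      rw [Sigma.ι_desc_assoc, hh, Category.comp_id]
  choose e he using h
  have hi (n j) : Sigma.ι (fun j => (A j).X n) j ≫ (e n).inv = M.i n j := by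
    rw [← he, Category.assoc, Iso.hom_inv_id, Category.comp_id]
  have hπ (n j) : (e n).hom ≫ Sigma.π (fun j => (A j).X n) j = M.π n j := by
    rw [← cancel_epi (e n).inv, Iso.inv_hom_id_assoc]
    refine Sigma.hom_ext _ _ fun j' => ?_
    rw [← Category.assoc, hi]
    by_cases h : j' = j
    · subst h
      rw [M.i_π_self n j' (Nat.zero_le _)]
      simp
    · rw [M.i_π_of_ne n j' j h]
      exact Sigma.ι_π_of_ne _ h
  refine ⟨e, fun n i j => ?_⟩
  unfold Bredon.component
  rw [← hi, ← hπ]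
  simp only [Category.assoc]

/-- A filtered complex whose subquotients are resolved by coproducts of complexes of projectives
has a model glued from these. -/
theorem exists_filteredModel [HasCoproducts.{u} C]
    [∀ K : Type u, HasExactColimitsOfShape (Discrete K) C]
    (hA : ∀ j n, Projective ((A j).X n))
    {F E : ℕ → ChainComplex C ℕ} (f : ∀ k, F (k + 1) ⟶ F k) (g : ∀ k, F k ⟶ E k)
    (w : ∀ k, f k ≫ g k = 0) (hS : ∀ k, (ShortComplex.mk (f k) (g k) (w k)).ShortExact)
    (ε : ∀ k (j : {j // r j = k}), A j ⟶ E k) (hε : ∀ k, QuasiIso (coprod.desc (ε k)))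
    (b : ℕ) (hb : ∀ j, r j < b) (hF : (F b).Acyclic) (k : ℕ) (hk : k ≤ b) :
    ∃ (M : FilteredModel r A k) (φ : M.Q ⟶ F k), QuasiIso φ := by
  induction hk using Nat.decreasingInduction with
  | self =>
    -- At level `b` there are no summands left and `F b` is acyclic, so the zero complex is a model.
    refine ⟨.zero hb, 0, ?_⟩
    rw [quasiIso_iff]
    intro n
    rw [quasiIsoAt_iff_exactAt]
    · exact hF n
    · exact ShortComplex.exact_of_isZero_X₂ _ (isZero_zero C)
  | of_succ k hk ih =>
    obtain ⟨M, φ, hφ⟩ := ih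
    have (n : ℕ) : Projective ((coprod fun j : {j // r j = k} => A j).X n) :=
      coprod.projective_X n fun j => hA j n
    have := hε k
    obtain ⟨u, hu, ψ, hψ⟩ := exists_twisted_quasiIso (hS k) φ (coprod.desc (ε k))
    exact ⟨M.extend u hu, ψ, hψ⟩

end Filtered

end ChainComplex

/-! ### Tensoring with a free permutation module -/

namespace Bredon

section FreeAction

open Representation TensorProduct

variable (R : Type u) [CommRing R] {W X : Type u} [Group W] [MulAction W X]

theorem permRep_single (w : W) (x : X) :
    permRep R W X w (Finsupp.single x 1) = Finsupp.single (w • x) 1 :=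
  Finsupp.mapDomain_single

section General

variable {R} {A U : Rep.{u} R W} {M : Type*} [AddCommGroup M] [Module R M]

theorem coinvariantsTensorMk_smul (w : W) (a : A) (v : U) :
    Rep.coinvariantsTensorMk A U (A.ρ w a) (U.ρ w v) = Rep.coinvariantsTensorMk A U a v :=
  Coinvariants.mk_self_apply (A.ρ.tprod U.ρ) w (a ⊗ₜ[R] v)

theorem coinvariantsTensor_linearMap_ext
    {f g : ((Rep.coinvariantsTensor R W).obj A).obj U →ₗ[R] M}
    (h : ∀ a v, f (Rep.coinvariantsTensorMk A U a v) = g (Rep.coinvariantsTensorMk A U a v)) :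
    f = g :=
  Coinvariants.hom_ext (ρ := A.ρ.tprod U.ρ) (TensorProduct.ext' h)

/-- An invariant bilinear map induces a map out of `A ⊗_W U`. -/
noncomputable def coinvariantsTensorDesc (β : A →ₗ[R] U →ₗ[R] M)
    (hβ : ∀ w a v, β (A.ρ w a) (U.ρ w v) = β a v) :
    ((Rep.coinvariantsTensor R W).obj A).obj U →ₗ[R] M :=
  Coinvariants.lift (A.ρ.tprod U.ρ) (TensorProduct.lift β)
    (fun w => TensorProduct.ext' fun a v => hβ w a v)

theorem coinvariantsTensorDesc_mk (β : A →ₗ[R] U →ₗ[R] M)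
    (hβ : ∀ w a v, β (A.ρ w a) (U.ρ w v) = β a v) (a : A) (v : U) :
    coinvariantsTensorDesc β hβ (Rep.coinvariantsTensorMk A U a v) = β a v :=
  rfl

end General

/-- The class `x ⊗ u` in `R⟨X⟩ ⊗_W U`. -/
noncomputable def tmk (U : Rep.{u} R W) (x : X) :
    U →ₗ[R] ((Rep.coinvariantsTensor R W).obj (Rep.of (permRep R W X))).obj U :=
  Rep.coinvariantsTensorMk (Rep.of (permRep R W X)) U (Finsupp.single x (1 : R))

theorem tmk_smul (U : Rep.{u} R W) (w : W) (x : X) (v : U) :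
    tmk R U (w • x) (U.ρ w v) = tmk R U x v := by
  have := coinvariantsTensorMk_smul (A := Rep.of (permRep R W X)) w (Finsupp.single x (1 : R)) v
  rw [tmk, tmk, ← this]
  exact congrArg (fun a => Rep.coinvariantsTensorMk (Rep.of (permRep R W X)) U a (U.ρ w v))
    (permRep_single R w x).symm

variable {R} in
theorem tmk_hom_ext {U : Rep.{u} R W} {M : Type*} [AddCommGroup M] [Module R M]
    {f g : ((Rep.coinvariantsTensor R W).obj (Rep.of (permRep R W X))).obj U →ₗ[R] M}
    (h : ∀ x v, f (tmk R U x v) = g (tmk R U x v)) : f = g := by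
  refine coinvariantsTensor_linearMap_ext fun a v => ?_
  have : (f ∘ₗ (Rep.coinvariantsTensorMk (Rep.of (permRep R W X)) U).flip v : (X →₀ R) →ₗ[R] M) =
      g ∘ₗ (Rep.coinvariantsTensorMk (Rep.of (permRep R W X)) U).flip v :=
    Finsupp.lhom_ext' fun x => LinearMap.ext_ring (h x v)
  exact LinearMap.congr_fun this a

section Desc

variable {R} {U : Rep.{u} R W} {M : Type*} [AddCommGroup M] [Module R M] (f : X → U →ₗ[R] M)

/-- The bilinear map underlying `tdesc`. -/
noncomputable def tdescAux : (X →₀ R) →ₗ[R] U →ₗ[R] M :=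
  Finsupp.lsum R fun x => LinearMap.toSpanSingleton R (U →ₗ[R] M) (f x)

omit [MulAction W X] in
theorem tdescAux_single (x : X) : tdescAux f (Finsupp.single x 1) = f x := by
  simp [tdescAux]

variable (hf : ∀ (w : W) (x : X) (v : U), f (w • x) (U.ρ w v) = f x v)

include hf in
theorem tdescAux_smul (w : W) (a : X →₀ R) (v : U) :
    tdescAux f (permRep R W X w a) (U.ρ w v) = tdescAux f a v := by
  induction a using Finsupp.induction_linear with
  | zero => simp
  | add a b ha hb => simp [ha, hb]
  | single x r =>
    rw [← mul_one r, ← smul_eq_mul, ← Finsupp.smul_single, map_smul, map_smul, map_smul,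
      permRep_single, tdescAux_single, tdescAux_single, LinearMap.smul_apply, hf,
      LinearMap.smul_apply]

/-- A family of linear maps compatible with the action induces a map out of `R⟨X⟩ ⊗_W U`. -/
noncomputable def tdesc :
    ((Rep.coinvariantsTensor R W).obj (Rep.of (permRep R W X))).obj U →ₗ[R] M :=
  coinvariantsTensorDesc (A := Rep.of (permRep R W X)) (tdescAux f) (tdescAux_smul f hf)

@[simp]
theorem tdesc_tmk (x : X) (v : U) : tdesc f hf (tmk R U x v) = f x v := by
  rw [tdesc, tmk, coinvariantsTensorDesc_mk]
  exact LinearMap.congr_fun (tdescAux_single f x) v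

end Desc

theorem map_tmk {U V : Rep.{u} R W} (g : U ⟶ V) (x : X) (v : U) :
    (((Rep.coinvariantsTensor R W).obj (Rep.of (permRep R W X))).map g).hom (tmk R U x v) =
      tmk R V x (g.hom v) :=
  rfl

/-- The orbit of `x`. -/
def orbitMk (W : Type u) [Group W] [MulAction W X] (x : X) : MulAction.orbitRel.Quotient W X :=
  Quotient.mk'' x

/-- The chosen representative of the orbit of `x`. -/
noncomputable def orbitRep (W : Type u) [Group W] [MulAction W X]
    (q : MulAction.orbitRel.Quotient W X) : X := Quotient.out q

theorem exists_smul_orbitRep (x : X) : ∃ w : W, w • orbitRep W (orbitMk W x) = x := by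
  have := @Quotient.mk_out _ (MulAction.orbitRel W X) x
  exact MulAction.orbitRel_apply.1 ((MulAction.orbitRel W X).symm this)

variable (hfree : ∀ (w : W) (x : X), w • x = x → w = 1)

variable (W) in
/-- An element carrying the chosen representative of the orbit of `x` to `x`. -/
noncomputable def fromOrbitRep (x : X) : W := (exists_smul_orbitRep (W := W) x).choose

theorem fromOrbitRep_smul (x : X) : fromOrbitRep W x • orbitRep W (orbitMk W x) = x :=
  (exists_smul_orbitRep x).choose_spec

theorem mk_smul_eq (w : W) (x : X) :
    orbitMk W (w • x) = orbitMk W x :=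
  Quotient.sound (MulAction.orbitRel_apply.2 ⟨w, rfl⟩)

include hfree in
-- By freeness only one group element carries the representative of an orbit to a given point, so
-- the choice is equivariant. This is where freeness enters the exactness proof.
theorem fromOrbitRep_smul_eq (w : W) (x : X) :
    fromOrbitRep W (w • x) = w * fromOrbitRep W x := by
  have h₁ := fromOrbitRep_smul (W := W) (w • x)
  rw [mk_smul_eq] at h₁
  have h₂ : (w * fromOrbitRep W x) • orbitRep W (orbitMk W x) = w • x := by
    rw [mul_smul, fromOrbitRep_smul]
  have := hfree ((w * fromOrbitRep W x)⁻¹ * fromOrbitRep W (w • x)) (orbitRep W (orbitMk W x)) (by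
    rw [mul_smul, h₁, ← h₂, inv_smul_smul])
  exact (inv_mul_eq_one.1 this).symm

variable {R} in
/-- For a free `W`-set `X`, the coordinates of an element of `R⟨X⟩ ⊗_W U`. -/
noncomputable def coords (hfree : ∀ (w : W) (x : X), w • x = x → w = 1) (U : Rep.{u} R W) :
    ((Rep.coinvariantsTensor R W).obj (Rep.of (permRep R W X))).obj U →ₗ[R]
      (MulAction.orbitRel.Quotient W X →₀ U) :=
  tdesc (fun x => Finsupp.lsingle (orbitMk W x) ∘ₗ U.ρ (fromOrbitRep W x)⁻¹) (fun w x v => by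
    simp [mk_smul_eq, fromOrbitRep_smul_eq hfree])

theorem coords_tmk (U : Rep.{u} R W) (x : X) (v : U) : coords hfree U (tmk R U x v) =
    Finsupp.single (orbitMk W x) (U.ρ (fromOrbitRep W x)⁻¹ v) :=
  tdesc_tmk _ _ _ _

variable (X) in
/-- The element of `R⟨X⟩ ⊗_W U` with given coordinates. -/
noncomputable def ofCoords (U : Rep.{u} R W) : (MulAction.orbitRel.Quotient W X →₀ U) →ₗ[R]
    ((Rep.coinvariantsTensor R W).obj (Rep.of (permRep R W X))).obj U :=
  Finsupp.lsum R fun q => tmk R U (orbitRep W q)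

theorem ofCoords_single (U : Rep.{u} R W) (q : MulAction.orbitRel.Quotient W X) (v : U) :
    ofCoords R X U (Finsupp.single q v) = tmk R U (orbitRep W q) v := by
  simp [ofCoords]

/-- If x = w x₀ with x₀ the representative, then x ⊗ v = x₀ ⊗ w⁻¹v. This one composite suffices for
exactness: it makes R⟨X⟩ ⊗_W U a natural retract of a sum of copies of U. -/
theorem ofCoords_coords (U : Rep.{u} R W)
    (m : ((Rep.coinvariantsTensor R W).obj (Rep.of (permRep R W X))).obj U) :
    ofCoords R X U (coords hfree U m) = m := by
  have : ofCoords R X U ∘ₗ coords hfree U = LinearMap.id := tmk_hom_ext fun x v => by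
    rw [LinearMap.comp_apply, coords_tmk, ofCoords_single, LinearMap.id_apply,
      ← tmk_smul R U (fromOrbitRep W x), fromOrbitRep_smul]
    exact congrArg (tmk R U x) (by simp)
  exact LinearMap.congr_fun this m

theorem coords_map {U V : Rep.{u} R W} (g : U ⟶ V)
    (m : ((Rep.coinvariantsTensor R W).obj (Rep.of (permRep R W X))).obj U) :
    coords hfree V ((((Rep.coinvariantsTensor R W).obj (Rep.of (permRep R W X))).map g).hom m) =
      Finsupp.mapRange.linearMap g.hom.toLinearMap (coords hfree U m) := by
  have : coords hfree V ∘ₗ (((Rep.coinvariantsTensor R W).obj (Rep.of (permRep R W X))).map g).hom =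
      Finsupp.mapRange.linearMap g.hom.toLinearMap ∘ₗ coords hfree U := tmk_hom_ext fun x v => by
    rw [LinearMap.comp_apply, LinearMap.comp_apply, map_tmk, coords_tmk, coords_tmk]
    simp [Rep.hom_comm_apply]
  exact LinearMap.congr_fun this m

theorem map_ofCoords {U V : Rep.{u} R W} (g : U ⟶ V) (m : MulAction.orbitRel.Quotient W X →₀ U) :
    (((Rep.coinvariantsTensor R W).obj (Rep.of (permRep R W X))).map g).hom (ofCoords R X U m) =
      ofCoords R X V (Finsupp.mapRange.linearMap g.hom.toLinearMap m) := by
  have : (((Rep.coinvariantsTensor R W).obj (Rep.of (permRep R W X))).map g).hom ∘ₗ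
      ofCoords R X U = ofCoords R X V ∘ₗ Finsupp.mapRange.linearMap g.hom.toLinearMap :=
    Finsupp.lhom_ext fun q v => by
      rw [LinearMap.comp_apply, LinearMap.comp_apply, ofCoords_single, map_tmk]
      simp only [Finsupp.mapRange.linearMap_apply, Finsupp.mapRange_single]
      exact (ofCoords_single R V q _).symm
  exact LinearMap.congr_fun this m

include hfree in
/-- For a free `W`-set `X`, the functor `R⟨X⟩ ⊗_W -` is exact. -/
theorem preservesHomology_of_free :
    ((Rep.coinvariantsTensor R W).obj (Rep.of (permRep R W X))).PreservesHomology := by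
  refine Functor.preservesHomology_of_map_exact _ fun S hS => ?_
  have := hS.map (forget₂ (Rep.{u} R W) (ModuleCat R))
  rw [ShortComplex.moduleCat_exact_iff] at this ⊢
  intro m hm
  have hc := coords_map R hfree S.g m
  have hm' : (((Rep.coinvariantsTensor R W).obj (Rep.of (permRep R W X))).map S.g).hom m = 0 := hm
  rw [hm', map_zero] at hc
  have h (q) : ∃ v : S.X₁, S.f.hom v = coords hfree S.X₂ m q :=
    this (coords hfree S.X₂ m q) (DFunLike.congr_fun hc.symm q)
  choose! v hv using h
  classical
  -- Preimages are chosen coordinate by coordinate. The chosen preimage of 0 need not be 0, so it is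
  -- replaced by 0 to keep the support finite.
  refine ⟨ofCoords R X S.X₁ (Finsupp.onFinset (coords hfree S.X₂ m).support
    (fun q => if coords hfree S.X₂ m q = 0 then 0 else v q) (fun q hq => by
      rw [Finsupp.mem_support_iff]
      rintro h
      simp [h] at hq)), ?_⟩
  refine (map_ofCoords R S.f _).trans ?_
  conv_rhs => rw [← ofCoords_coords R hfree S.X₂ m]
  congr 1
  ext q
  by_cases h : coords hfree S.X₂ m q = 0
  · simp [h]
  · simp [h, hv]

end FreeAction
end Bredon

/-! ### Induced contramodules: exactness, maps out of them, projectivity -/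

namespace Bredon

variable {G : Type u} [Group G] {𝓗 : ClassOfSubgroups G}

/-- The action of `WH` on maps to `G ⧸ H` commutes with precomposition. -/
theorem comp_weyl_smul {K L H : Orb 𝓗} (w : Weyl H.sub) (f : K ⟶ L) (g : L ⟶ H) :
    f ≫ (w • g) = w • (f ≫ g) := by
  induction w using QuotientGroup.induction_on
  rfl

/-- The Weyl group acts through the endomorphisms `w • 𝟙 H` of the orbit, and therefore acts on the
value at `H` of every contramodule. -/
theorem comp_weyl_smul_id {K H : Orb 𝓗} (w : Weyl H.sub) (f : K ⟶ H) :
    f ≫ (w • 𝟙 H) = w • f := by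
  rw [comp_weyl_smul, Category.comp_id]

/-- `WH` acts freely on the maps to `G ⧸ H`. -/
theorem weyl_eq_one_of_smul_eq {K H : Orb 𝓗} (w : Weyl H.sub) (f : K ⟶ H) (h : w • f = f) :
    w = 1 := by
  induction w using QuotientGroup.induction_on with
  | H n =>
    have h₁ : rightTranslation H.sub n⁻¹ (Orb.toMap f (1 : G)) = Orb.toMap f (1 : G) :=
      DFunLike.congr_fun (F := G ⧸ K.sub →[G] G ⧸ H.sub) h ((1 : G) : G ⧸ K.sub)
    induction hx : Orb.toMap f (1 : G) using QuotientGroup.induction_on with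
    | H x =>
      rw [hx] at h₁
      have h₂ := QuotientGroup.eq.1 h₁
      rw [QuotientGroup.eq_one_iff, Subgroup.mem_subgroupOf]
      simpa using h₂

variable (R : Type u) [CommRing R]

instance (H : Orb 𝓗) : (ind R H).Additive where
  map_add {U V f g} := by
    ext L : 2
    exact ((Rep.coinvariantsTensor R (Weyl H.sub)).obj ((freeContramodule R H).obj L)).map_add

theorem preservesHomology_ind_obj (H : Orb 𝓗) (L : (Orb 𝓗)ᵒᵖ) :
    ((Rep.coinvariantsTensor R (Weyl H.sub)).obj
      ((freeContramodule R H).obj L)).PreservesHomology :=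
  preservesHomology_of_free R (X := L.unop ⟶ H) weyl_eq_one_of_smul_eq

/-- The chain complex of contramodules induced from a chain complex of `WH`-modules. -/
noncomputable abbrev indComplex (H : Orb 𝓗) (P : ChainComplex (Rep.{u} R (Weyl H.sub)) ℕ) :
    ChainComplex (Contramodule R 𝓗) ℕ :=
  ((ind R H).mapHomologicalComplex _).obj P

/-- Tested at each orbit `L`, where induction is the tensor product with the permutation module of
the free `WH`-set of maps `L ⟶ H`. -/
theorem quasiIso_ind_map (H : Orb 𝓗) {P P' : ChainComplex (Rep.{u} R (Weyl H.sub)) ℕ}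
    (φ : P ⟶ P') [QuasiIso φ] : QuasiIso (((ind R H).mapHomologicalComplex _).map φ) := by
  rw [HomologicalComplex.quasiIso_iff_evaluation]
  intro L
  have := preservesHomology_ind_obj R H L
  exact inferInstanceAs (QuasiIso ((((Rep.coinvariantsTensor R (Weyl H.sub)).obj
      ((freeContramodule R H).obj L)).mapHomologicalComplex _).map φ))

/-! Morphisms out of induced contramodules. -/

variable {R}

/-- The class of `f ⊗ v` in `(ind R H).obj U` at `L`. -/
noncomputable def indMk {H L : Orb 𝓗} (U : Rep.{u} R (Weyl H.sub)) (f : L ⟶ H) :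
    U →ₗ[R] ((ind R H).obj U).obj (Opposite.op L) :=
  tmk R U f

theorem indMk_smul {H L : Orb 𝓗} (U : Rep.{u} R (Weyl H.sub)) (f : L ⟶ H) (w : Weyl H.sub)
    (v : U) : indMk U (w • f) (U.ρ w v) = indMk U f v :=
  tmk_smul R U w f v

theorem ind_map_indMk {H L L' : Orb 𝓗} (U : Rep.{u} R (Weyl H.sub)) (f : L ⟶ H) (g : L' ⟶ L)
    (v : U) : (((ind R H).obj U).map g.op).hom (indMk U f v) = indMk U (g ≫ f) v := by
  exact congrArg (fun a => Rep.coinvariantsTensorMk (Rep.of (permRep R (Weyl H.sub) (L' ⟶ H))) U a v)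
    (Finsupp.mapDomain_single (f := (g ≫ · : (L ⟶ H) → (L' ⟶ H))) (a := f) (b := (1 : R)))

theorem ind_linearMap_ext {H L : Orb 𝓗} {U : Rep.{u} R (Weyl H.sub)} {M : Type*} [AddCommGroup M]
    [Module R M] {φ ψ : ((ind R H).obj U).obj (Opposite.op L) →ₗ[R] M}
    (h : ∀ (f : L ⟶ H) (v : U), φ (indMk U f v) = ψ (indMk U f v)) : φ = ψ :=
  tmk_hom_ext h

theorem ind_hom_ext {H : Orb 𝓗} {U : Rep.{u} R (Weyl H.sub)} {M : Contramodule R 𝓗}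
    {φ ψ : (ind R H).obj U ⟶ M}
    (h : ∀ (L : Orb 𝓗) (f : L ⟶ H) (v : U), (φ.app (Opposite.op L)).hom (indMk U f v) =
      (ψ.app (Opposite.op L)).hom (indMk U f v)) : φ = ψ := by
  ext L : 2
  apply ModuleCat.hom_ext
  exact ind_linearMap_ext (L := L.unop) (h L.unop)

/-- Linear maps out of an induced contramodule at `L`. -/
noncomputable def indLinearDesc {H L : Orb 𝓗} {U : Rep.{u} R (Weyl H.sub)} {M : Type*}
    [AddCommGroup M] [Module R M] (φ : (L ⟶ H) → U →ₗ[R] M)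
    (hφ : ∀ (w : Weyl H.sub) f v, φ (w • f) (U.ρ w v) = φ f v) :
    ((ind R H).obj U).obj (Opposite.op L) →ₗ[R] M :=
  tdesc φ hφ

@[simp]
theorem indLinearDesc_indMk {H L : Orb 𝓗} {U : Rep.{u} R (Weyl H.sub)} {M : Type*}
    [AddCommGroup M] [Module R M] (φ : (L ⟶ H) → U →ₗ[R] M)
    (hφ : ∀ (w : Weyl H.sub) f v, φ (w • f) (U.ρ w v) = φ f v) (f : L ⟶ H) (v : U) :
    indLinearDesc φ hφ (indMk U f v) = φ f v :=
  tdesc_tmk φ hφ f v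

section IndDesc

variable {H : Orb 𝓗} {U : Rep.{u} R (Weyl H.sub)} {M : Contramodule R 𝓗}
  (ψ : U →ₗ[R] M.obj (Opposite.op H))
  (hψ : ∀ (w : Weyl H.sub) v, (M.map (w • 𝟙 H).op).hom (ψ (U.ρ w v)) = ψ v)

/-- The value of `indDesc` at `L`. -/
noncomputable def indDescApp (L : Orb 𝓗) :
    ((ind R H).obj U).obj (Opposite.op L) →ₗ[R] M.obj (Opposite.op L) :=
  indLinearDesc (fun f => (M.map f.op).hom ∘ₗ ψ)
    (fun w f v => by
      change (M.map (w • f).op).hom (ψ (U.ρ w v)) = (M.map f.op).hom (ψ v)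
      rw [← hψ w v, ← comp_weyl_smul_id, op_comp, M.map_comp]
      rfl)

theorem indDescApp_indMk {L : Orb 𝓗} (f : L ⟶ H) (v : U) :
    indDescApp ψ hψ L (indMk U f v) = (M.map f.op).hom (ψ v) :=
  indLinearDesc_indMk _ _ f v

/-- Morphisms out of an induced contramodule, from an equivariant map to the value at `H`. -/
noncomputable def indDesc : (ind R H).obj U ⟶ M where
  app L := ModuleCat.ofHom (indDescApp ψ hψ L.unop)
  naturality L L' g := by
    apply ModuleCat.hom_ext
    refine ind_linearMap_ext (L := L.unop) fun f v => ?_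
    refine (congrArg (indDescApp ψ hψ L'.unop) (ind_map_indMk U f g.unop v)).trans ?_
    change _ = (M.map g).hom (indDescApp ψ hψ L.unop (indMk U f v))
    rw [indDescApp_indMk, indDescApp_indMk, op_comp, M.map_comp]
    rfl

theorem indDesc_app_indMk {L : Orb 𝓗} (f : L ⟶ H) (v : U) :
    ((indDesc ψ hψ).app (Opposite.op L)).hom (indMk U f v) = (M.map f.op).hom (ψ v) :=
  indDescApp_indMk ψ hψ f v

end IndDesc

/-! Projectivity. -/

/-- The value of a contramodule at `H`, as a representation of `WH`. -/
noncomputable def weylRep (M : Contramodule R 𝓗) (H : Orb 𝓗) :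
    Rep.{u} R (Weyl H.sub) :=
  Rep.of (X := M.obj (Opposite.op H))
    -- Contravariance turns `w ↦ w • 𝟙 H` into a right action on the value; the inverse makes it a
    -- left action.
    { toFun := fun w => (M.map (w⁻¹ • 𝟙 H).op).hom
      map_one' := by
        rw [inv_one, one_smul, op_id, M.map_id]
        rfl
      map_mul' := fun v w => by
        rw [mul_inv_rev, mul_smul, ← comp_weyl_smul_id, op_comp, M.map_comp]
        rfl }

/-- The map of representations induced by a map of contramodules. -/
noncomputable def weylRepMap {M N : Contramodule R 𝓗} (φ : M ⟶ N) (H : Orb 𝓗) :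
    weylRep M H ⟶ weylRep N H :=
  Rep.ofHom ⟨(φ.app (Opposite.op H)).hom, fun w => by
    have := φ.naturality (w⁻¹ • 𝟙 H).op
    exact (congrArg ModuleCat.Hom.hom this)⟩

theorem projective_of_free {W : Type u} [Group W] (U : Rep.{u} R W)
    [Module.Free R[W] U.ρ.asModule] : Projective U := by
  refine Rep.equivalenceModuleMonoidAlgebra.toAdjunction.projective_of_map_projective _ ?_
  exact ModuleCat.projective_of_free (M := ModuleCat.of R[W] U.ρ.asModule)
    (Module.Free.chooseBasis R[W] U.ρ.asModule)

/-- `ind` sends projective representations to projective contramodules. -/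
theorem projective_ind (H : Orb 𝓗) (U : Rep.{u} R (Weyl H.sub)) [Projective U] :
    Projective ((ind R H).obj U) where
  factors {E B} f e _ := by
    -- `f'` is the transpose of `f` under the adjunction between induction and evaluation at `H`.
    -- Evaluation preserves epimorphisms, so `f'` lifts through `e`, and the lift is transposed back
    -- by `indDesc`.
    let f' : U ⟶ weylRep B H := Rep.ofHom ⟨(f.app (Opposite.op H)).hom ∘ₗ indMk U (𝟙 H), fun w => by
      refine LinearMap.ext fun v => ?_
      change (f.app (Opposite.op H)).hom (indMk U (𝟙 H) (U.ρ w v)) =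
        (B.map (w⁻¹ • 𝟙 H).op).hom ((f.app (Opposite.op H)).hom (indMk U (𝟙 H) v))
      have := LinearMap.congr_fun (congrArg ModuleCat.Hom.hom (f.naturality (w⁻¹ • 𝟙 H).op))
        (indMk U (𝟙 H) v)
      refine Eq.trans ?_ this
      change _ = (f.app (Opposite.op H)).hom
        ((((ind R H).obj U).map (w⁻¹ • 𝟙 H).op).hom (indMk U (𝟙 H) v))
      rw [ind_map_indMk, Category.comp_id, ← indMk_smul U (w⁻¹ • 𝟙 H) w v, smul_inv_smul]⟩
    have : Epi (weylRepMap e H) := by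
      rw [Rep.epi_iff_surjective]
      exact (ModuleCat.epi_iff_surjective (e.app (Opposite.op H))).1 inferInstance
    let g : U ⟶ weylRep E H := Projective.factorThru f' (weylRepMap e H)
    have hg : g ≫ weylRepMap e H = f' := Projective.factorThru_comp _ _
    have hg' (v : U) : (e.app (Opposite.op H)).hom (g.hom v) =
        (f.app (Opposite.op H)).hom (indMk U (𝟙 H) v) :=
      congrArg (fun q : U ⟶ weylRep B H => q.hom v) hg
    have hgw (w : Weyl H.sub) (v : U) : (E.map (w • 𝟙 H).op).hom (g.hom (U.ρ w v)) = g.hom v := by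
      have h₁ : g.hom (U.ρ w v) = (weylRep E H).ρ w (g.hom v) := Rep.hom_comm_apply g w v
      have h₂ : (weylRep E H).ρ w⁻¹ ((weylRep E H).ρ w (g.hom v)) = g.hom v := by simp
      rw [h₁]
      refine Eq.trans ?_ h₂
      change _ = (E.map (w⁻¹⁻¹ • 𝟙 H).op).hom _
      rw [inv_inv]
    let ψ : U →ₗ[R] E.obj (Opposite.op H) := g.hom.toLinearMap
    refine ⟨indDesc ψ hgw, ?_⟩
    refine ind_hom_ext fun L q v => ?_
    rw [NatTrans.comp_app, ModuleCat.hom_comp, LinearMap.comp_apply, indDesc_app_indMk]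
    have h₁ := LinearMap.congr_fun (congrArg ModuleCat.Hom.hom (e.naturality q.op)) (g.hom v)
    have h₂ := LinearMap.congr_fun (congrArg ModuleCat.Hom.hom (f.naturality q.op))
      (indMk U (𝟙 H) v)
    refine h₁.trans ?_
    refine (congrArg (B.map q.op).hom (hg' v)).trans ?_
    refine h₂.symm.trans ?_
    change (f.app (Opposite.op L)).hom ((((ind R H).obj U).map q.op).hom (indMk U (𝟙 H) v)) = _
    rw [ind_map_indMk, Category.comp_id]

end Bredon

/-! ### Flags of subgroups as contramodules -/

namespace Bredon

variable {G : Type u} [Group G] {𝓗 : ClassOfSubgroups G}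

/-! Conjugation along maps of orbits. -/

/-- Elements of `L` normalize every `K ≥ L`, so the conjugate of `K` depends only on the coset of
`x`. Conjugation along a map of orbits is therefore independent of the choice made in `homRep`. -/
theorem conj_smul_eq_of_mk_eq {L K : Subgroup G} (h : L ≤ K) {x y : G}
    (hxy : (x : G ⧸ L) = y) : MulAut.conj x • K = MulAut.conj y • K := by
  have := conj_smul_eq_self_of_mem (h (QuotientGroup.eq.1 hxy))
  rw [map_mul, mul_smul, map_inv, inv_smul_eq_iff] at this
  exact this.symm

theorem conj_smul_lt {K L : Subgroup G} (x : G) (h : K < L) :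
    MulAut.conj x • K < MulAut.conj x • L := by
  rwa [lt_iff_le_not_ge, Subgroup.pointwise_smul_le_pointwise_smul_iff,
    Subgroup.pointwise_smul_le_pointwise_smul_iff, ← lt_iff_le_not_ge]

/-- A group element `x` with `f (L) = x L'` for a map `f : G ⧸ L ⟶ G ⧸ L'`. -/
noncomputable def homRep {L L' : Orb 𝓗} (f : L ⟶ L') : G :=
  Quotient.out (Orb.toMap f ((1 : G) : G ⧸ L.sub))

theorem mk_homRep {L L' : Orb 𝓗} (f : L ⟶ L') :
    ((homRep f : G) : G ⧸ L'.sub) = Orb.toMap f ((1 : G) : G ⧸ L.sub) :=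
  Quotient.out_eq' _

theorem toMap_mk {L L' : Orb 𝓗} (f : L ⟶ L') (g : G) :
    Orb.toMap f (g : G ⧸ L.sub) = ((g * homRep f : G) : G ⧸ L'.sub) := by
  have h₁ : (g : G ⧸ L.sub) = g • ((1 : G) : G ⧸ L.sub) := by
    rw [MulAction.Quotient.smul_coe, smul_eq_mul, mul_one]
  rw [h₁, MulActionHom.map_smul, ← mk_homRep, MulAction.Quotient.smul_coe, smul_eq_mul]

theorem conj_homRep_id {L : Orb 𝓗} {K : Subgroup G} (h : L.sub ≤ K) :
    MulAut.conj (homRep (𝟙 L)) • K = K := by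
  have h' : ((homRep (𝟙 L) : G) : G ⧸ L.sub) = (1 : G) := mk_homRep (𝟙 L)
  rw [conj_smul_eq_of_mk_eq h h', map_one, one_smul]

theorem conj_homRep_comp {L₁ L₂ L₃ : Orb 𝓗} (f : L₁ ⟶ L₂) (g : L₂ ⟶ L₃) {K : Subgroup G}
    (h : L₃.sub ≤ K) :
    MulAut.conj (homRep (f ≫ g)) • K = MulAut.conj (homRep f) • MulAut.conj (homRep g) • K := by
  rw [← mul_smul, ← map_mul]
  refine conj_smul_eq_of_mk_eq h ?_
  rw [mk_homRep, ← toMap_mk, mk_homRep]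
  rfl

/-- `L` fixes its own coset, hence also the image `x L'` of that coset, whose stabilizer is the
conjugate of `L'` by `x`. -/
theorem le_conj_homRep {L L' : Orb 𝓗} (f : L ⟶ L') :
    L.sub ≤ MulAut.conj (homRep f) • L'.sub := by
  intro l hl
  rw [Subgroup.mem_pointwise_smul_iff_inv_smul_mem]
  have h : (l : G ⧸ L.sub) = (1 : G) := by
    rw [QuotientGroup.eq]
    simpa using hl
  have h' := toMap_mk f l
  rw [h, ← mk_homRep, QuotientGroup.eq] at h'
  rw [← map_inv, MulAut.smul_def, MulAut.conj_apply]
  simpa [mul_assoc] using h'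

theorem exists_hom_of_le_conj {L L' : Orb 𝓗} (x : G) (h : L.sub ≤ MulAut.conj x • L'.sub) :
    ∃ f : L ⟶ L', ((homRep f : G) : G ⧸ L'.sub) = x := by
  have h' (a b : G) (hab : a⁻¹ * b ∈ L.sub) : ((a * x : G) : G ⧸ L'.sub) = ((b * x : G)) := by
    have := h hab
    rw [Subgroup.mem_pointwise_smul_iff_inv_smul_mem, ← map_inv, MulAut.smul_def,
      MulAut.conj_apply] at this
    rw [QuotientGroup.eq]
    simpa [mul_assoc] using this
  let f : G ⧸ L.sub →[G] G ⧸ L'.sub :=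
    { toFun := Quotient.lift (fun a => ((a * x : G) : G ⧸ L'.sub))
        (fun a b hab => h' a b (QuotientGroup.leftRel_apply.1 hab))
      map_smul' := fun g y => by
        induction y using QuotientGroup.induction_on
        exact congrArg QuotientGroup.mk (mul_assoc g _ _) }
  refine ⟨f, (mk_homRep (𝓗 := 𝓗) (L := L) (L' := L') f).trans ?_⟩
  exact congrArg QuotientGroup.mk (one_mul x)

theorem hom_ext_of_homRep {L L' : Orb 𝓗} {f g : L ⟶ L'}
    (h : ((homRep f : G) : G ⧸ L'.sub) = (homRep g : G)) : f = g := by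
  apply MulActionHom.ext
  intro y
  induction y using QuotientGroup.induction_on with
  | H a =>
    refine (toMap_mk f a).trans (Eq.trans ?_ (toMap_mk g a).symm)
    have := congrArg (a • ·) h
    simpa only [MulAction.Quotient.smul_coe, smul_eq_mul] using this

/-! Chains. -/

/-- The strictly increasing chains `K₀ < ⋯ < K_n` in `𝓗` with `L ≤ K₀`. -/
def Flag (𝓗 : ClassOfSubgroups G) (L : Subgroup G) (n : ℕ) : Type u :=
  {c : Fin (n + 1) → Subgroup G // StrictMono c ∧ (∀ i, c i ∈ 𝓗.carrier) ∧ L ≤ c 0}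

namespace Flag

theorem ext {L : Subgroup G} {n : ℕ} {c d : Flag 𝓗 L n} (h : ∀ i, c.1 i = d.1 i) : c = d :=
  Subtype.ext (funext h)

theorem le {L : Subgroup G} {n : ℕ} (c : Flag 𝓗 L n) (i : Fin (n + 1)) : L ≤ c.1 i :=
  c.2.2.2.trans (c.2.1.monotone (Fin.zero_le i))

/-- Conjugate a chain along a map of orbits. -/
noncomputable def res {L L' : Orb 𝓗} (f : L ⟶ L') {n : ℕ} (c : Flag 𝓗 L'.sub n) :
    Flag 𝓗 L.sub n :=
  ⟨fun i => MulAut.conj (homRep f) • c.1 i, fun _ _ h => conj_smul_lt _ (c.2.1 h),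
    fun i => 𝓗.conj_mem _ (c.2.2.1 i), (le_conj_homRep f).trans
      (Subgroup.pointwise_smul_le_pointwise_smul_iff.2 c.2.2.2)⟩

theorem res_id {L : Orb 𝓗} {n : ℕ} (c : Flag 𝓗 L.sub n) : c.res (𝟙 L) = c :=
  ext fun i => conj_homRep_id (c.le i)

theorem res_comp {L₁ L₂ L₃ : Orb 𝓗} (f : L₁ ⟶ L₂) (g : L₂ ⟶ L₃) {n : ℕ}
    (c : Flag 𝓗 L₃.sub n) : c.res (f ≫ g) = (c.res g).res f :=
  ext fun i => conj_homRep_comp f g (c.le i)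

/-- Omit the `i`-th member of a chain. -/
def face {L : Subgroup G} {n : ℕ} (i : Fin (n + 2)) (c : Flag 𝓗 L (n + 1)) : Flag 𝓗 L n :=
  ⟨fun j => c.1 (i.succAbove j), c.2.1.comp (Fin.strictMono_succAbove i), fun _ => c.2.2.1 _,
    c.le _⟩

theorem zero_le_face_zero {L : Subgroup G} {n : ℕ} (i : Fin (n + 2)) (c : Flag 𝓗 L (n + 1)) :
    c.1 0 ≤ (c.face i).1 0 :=
  c.2.1.monotone (Fin.zero_le _)

theorem face_succ_zero {L : Subgroup G} {n : ℕ} (i : Fin (n + 1)) (c : Flag 𝓗 L (n + 1)) :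
    (c.face i.succ).1 0 = c.1 0 :=
  congrArg c.1 (Fin.succ_succAbove_zero i)

theorem lt_face_zero_zero {L : Subgroup G} {n : ℕ} (c : Flag 𝓗 L (n + 1)) :
    c.1 0 < (c.face 0).1 0 :=
  c.2.1 (by simp)

theorem face_face {L : Subgroup G} {n : ℕ} (i : Fin (n + 3)) (j : Fin (n + 2))
    (c : Flag 𝓗 L (n + 2)) :
    (c.face (i.succAbove j)).face (j.predAbove i) = (c.face i).face j :=
  ext fun k => congrArg c.1 (Fin.succAbove_succAbove_succAbove_predAbove i j k)

/-- Prepend a smaller subgroup to a chain. -/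
def cons {L K : Subgroup G} (hK : K ∈ 𝓗.carrier) (hL : L ≤ K) {n : ℕ} (c : Fin n → Subgroup G)
    (hc : StrictMono c) (hc' : ∀ i, c i ∈ 𝓗.carrier) (hlt : ∀ i, K < c i) : Flag 𝓗 L n :=
  ⟨Fin.cons K c, by
    intro i j h
    induction j using Fin.cases with
    | zero => exact absurd h (Fin.not_lt_zero i)
    | succ j =>
      induction i using Fin.cases with
      | zero => exact hlt j
      | succ i => exact hc (Fin.succ_lt_succ_iff.1 h), fun i => by
    induction i using Fin.cases with
    | zero => exact hK
    | succ i => exact hc' i, hL⟩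

end Flag

/-! Ranks and layers. -/

variable (𝓗) in
/-- A strictly monotone conjugation invariant function on `𝓗`. -/
structure Rank where
  toFun : Subgroup G → ℕ
  lt : ∀ {K L}, K ∈ 𝓗.carrier → L ∈ 𝓗.carrier → K < L → toFun K < toFun L
  conj : ∀ (g : G) {K}, K ∈ 𝓗.carrier → toFun (MulAut.conj g • K) = toFun K

variable (r : Rank 𝓗)

theorem Rank.le {K L : Subgroup G} (hK : K ∈ 𝓗.carrier) (hL : L ∈ 𝓗.carrier) (h : K ≤ L) :
    r.toFun K ≤ r.toFun L := by
  rcases h.eq_or_lt with rfl | h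
  · exact le_rfl
  · exact (r.lt hK hL h).le

/-- The rank of the smallest member of a chain. -/
def Flag.rank {L : Subgroup G} {n : ℕ} (c : Flag 𝓗 L n) : ℕ := r.toFun (c.1 0)

theorem Flag.rank_res {L L' : Orb 𝓗} (f : L ⟶ L') {n : ℕ} (c : Flag 𝓗 L'.sub n) :
    (c.res f).rank r = c.rank r :=
  r.conj _ (c.2.2.1 0)

theorem Flag.rank_le_rank_face {L : Subgroup G} {n : ℕ} (i : Fin (n + 2))
    (c : Flag 𝓗 L (n + 1)) : c.rank r ≤ (c.face i).rank r :=
  r.le (c.2.2.1 _) (c.2.2.1 _) (c.zero_le_face_zero i)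

/-- This strict inequality makes the zeroth face vanish in a layer of a single rank. -/
theorem Flag.rank_lt_rank_face_zero {L : Subgroup G} {n : ℕ}
    (c : Flag 𝓗 L (n + 1)) : c.rank r < (c.face 0).rank r :=
  r.lt (c.2.2.1 _) (c.2.2.1 _) c.lt_face_zero_zero

/-- The chains whose smallest member has rank in `I`. -/
def Layer (I : Set ℕ) (L : Subgroup G) (n : ℕ) : Type u := {c : Flag 𝓗 L n // c.rank r ∈ I}

variable (R : Type u) [CommRing R]

section Restrict

variable {r} {L : Subgroup G} {n : ℕ}

open Classical in
/-- The basis element of `c`, or `0` if the rank of `c` is not in `I`. -/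
noncomputable def restrict (I : Set ℕ) (c : Flag 𝓗 L n) : Layer r I L n →₀ R :=
  if h : c.rank r ∈ I then Finsupp.single ⟨c, h⟩ 1 else 0

variable {R}

theorem restrict_of_mem {I : Set ℕ} {c : Flag 𝓗 L n} (h : c.rank r ∈ I) :
    restrict R I c = (Finsupp.single ⟨c, h⟩ 1 : Layer r I L n →₀ R) := by
  simp [restrict, h]

theorem restrict_of_notMem {I : Set ℕ} {c : Flag 𝓗 L n} (h : c.rank r ∉ I) :
    restrict R I c = (0 : Layer r I L n →₀ R) := by
  simp [restrict, h]

theorem layer_linearMap_ext {I : Set ℕ} {M : Type*} [AddCommGroup M] [Module R M]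
    {f g : (Layer r I L n →₀ R) →ₗ[R] M}
    (h : ∀ c : Flag 𝓗 L n, c.rank r ∈ I → f (restrict R I c) = g (restrict R I c)) : f = g :=
  Finsupp.lhom_ext' fun c => LinearMap.ext_ring (by
    have := h c.1 c.2
    rwa [restrict_of_mem c.2] at this)

/-- The linear map with given values on chains. -/
noncomputable def layerDesc (I : Set ℕ) {M : Type*} [AddCommGroup M] [Module R M]
    (f : Flag 𝓗 L n → M) : (Layer r I L n →₀ R) →ₗ[R] M :=
  Finsupp.linearCombination R fun c => f c.1

theorem layerDesc_restrict {I : Set ℕ} {M : Type*} [AddCommGroup M] [Module R M]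
    (f : Flag 𝓗 L n → M) {c : Flag 𝓗 L n} (h : c.rank r ∈ I) :
    layerDesc (r := r) I f (restrict R I c) = f c := by
  rw [restrict_of_mem h]
  exact (Finsupp.linearCombination_single R _ _).trans (one_smul _ _)

theorem layerDesc_restrict_of_imp {I : Set ℕ} {M : Type*} [AddCommGroup M] [Module R M]
    (f : Flag 𝓗 L n → M) {c : Flag 𝓗 L n} (h : c.rank r ∉ I → f c = 0) :
    layerDesc (r := r) I f (restrict R I c) = f c := by
  by_cases hc : c.rank r ∈ I
  · exact layerDesc_restrict f hc
  · rw [restrict_of_notMem hc, map_zero, h hc]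

end Restrict

section LayerRes

variable {r} {I : Set ℕ} {n : ℕ}

/-- Conjugation of chains along a map of orbits. -/
noncomputable def layerRes {L L' : Orb 𝓗} (f : L ⟶ L') :
    (Layer r I L'.sub n →₀ R) →ₗ[R] (Layer r I L.sub n →₀ R) :=
  layerDesc I fun c => restrict R I (c.res f)

variable {R}

theorem layerRes_restrict {L L' : Orb 𝓗} (f : L ⟶ L') (c : Flag 𝓗 L'.sub n) :
    layerRes R f (restrict R I c) = (restrict R I (c.res f) : Layer r I L.sub n →₀ R) :=
  layerDesc_restrict_of_imp _ fun h => restrict_of_notMem (by rwa [Flag.rank_res])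

variable (R)

theorem layerRes_id (L : Orb 𝓗) :
    layerRes R (𝟙 L) = (LinearMap.id : (Layer r I L.sub n →₀ R) →ₗ[R] _) :=
  layer_linearMap_ext fun c _ => by rw [layerRes_restrict, Flag.res_id, LinearMap.id_apply]

theorem layerRes_comp {L₁ L₂ L₃ : Orb 𝓗} (f : L₁ ⟶ L₂) (g : L₂ ⟶ L₃) :
    (layerRes R (f ≫ g) : (Layer r I L₃.sub n →₀ R) →ₗ[R] _) =
      layerRes R f ∘ₗ layerRes R g :=
  layer_linearMap_ext fun c _ => by
    rw [LinearMap.comp_apply, layerRes_restrict, layerRes_restrict, layerRes_restrict,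
      Flag.res_comp]

end LayerRes

/-- The contramodule of chains whose smallest member has rank in `I`. -/
noncomputable def layerModule (I : Set ℕ) (n : ℕ) : Contramodule R 𝓗 where
  obj L := ModuleCat.of R (Layer r I L.unop.sub n →₀ R)
  map f := ModuleCat.ofHom (layerRes R f.unop)
  map_id L := congrArg ModuleCat.ofHom (layerRes_id R L.unop)
  map_comp f g := congrArg ModuleCat.ofHom (layerRes_comp R g.unop f.unop)

theorem layerModule_map_restrict {I : Set ℕ} {n : ℕ} {L L' : Orb 𝓗} (f : L ⟶ L')
    (c : Flag 𝓗 L'.sub n) : ((layerModule r R I n).map f.op).hom (restrict R I c) =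
      restrict R I (c.res f) :=
  layerRes_restrict f c

/-- A natural transformation out of `layerModule`, from its values on chains. -/
noncomputable def layerModuleDesc {I : Set ℕ} {n : ℕ} {M : Contramodule R 𝓗}
    (f : ∀ L : Orb 𝓗, Flag 𝓗 L.sub n → M.obj (Opposite.op L))
    (hf : ∀ (L L' : Orb 𝓗) (g : L ⟶ L') (c : Flag 𝓗 L'.sub n), c.rank r ∈ I →
      (M.map g.op).hom (f L' c) = f L (c.res g)) : layerModule r R I n ⟶ M where
  app L := ModuleCat.ofHom (layerDesc I (f L.unop))
  naturality L L' g := by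
    apply ModuleCat.hom_ext
    refine layer_linearMap_ext fun c hc => ?_
    refine (congrArg (layerDesc I (f L'.unop)) (layerRes_restrict g.unop c)).trans ?_
    refine (layerDesc_restrict _ (by rwa [Flag.rank_res])).trans ((hf _ _ g.unop c hc).symm.trans ?_)
    exact congrArg (M.map g).hom (layerDesc_restrict _ hc).symm

variable {R r} in
theorem layerModule_hom_ext {I : Set ℕ} {n : ℕ} {M : Contramodule R 𝓗}
    {f g : layerModule r R I n ⟶ M} (h : ∀ (L : Orb 𝓗) (c : Flag 𝓗 L.sub n), c.rank r ∈ I →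
      (f.app (Opposite.op L)).hom (restrict R I c) = (g.app (Opposite.op L)).hom (restrict R I c)) :
    f = g := by
  ext L : 2
  apply ModuleCat.hom_ext
  exact layer_linearMap_ext (h L.unop)

theorem layerModuleDesc_app_restrict {I : Set ℕ} {n : ℕ} {M : Contramodule R 𝓗}
    (f : ∀ L : Orb 𝓗, Flag 𝓗 L.sub n → M.obj (Opposite.op L))
    (hf : ∀ (L L' : Orb 𝓗) (g : L ⟶ L') (c : Flag 𝓗 L'.sub n), c.rank r ∈ I →
      (M.map g.op).hom (f L' c) = f L (c.res g)) {L : Orb 𝓗} {c : Flag 𝓗 L.sub n}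
      (hc : c.rank r ∈ I) :
    ((layerModuleDesc r R f hf).app (Opposite.op L)).hom (restrict R I c) = f L c :=
  layerDesc_restrict _ hc

end Bredon

/-! ### The flag complex and its filtration by rank -/

theorem CategoryTheory.ShortComplex.shortExact_of_evaluation {D C : Type*} [Category* D]
    [Category* C] [Abelian C] (S : ShortComplex (D ⥤ C))
    (h : ∀ X, (S.map ((evaluation D C).obj X)).ShortExact) : S.ShortExact where
  exact := S.exact_iff_isZero_homology.2 <| Functor.isZero _ fun X =>
    (((S.map ((evaluation D C).obj X)).exact_iff_isZero_homology).1 (h X).exact).of_iso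
      (S.mapHomologyIso ((evaluation D C).obj X)).symm
  mono_f := by
    have (X : D) : Mono (S.f.app X) := (h X).mono_f
    exact NatTrans.mono_of_mono_app S.f
  epi_g := by
    have (X : D) : Epi (S.g.app X) := (h X).epi_g
    exact NatTrans.epi_of_epi_app S.g

namespace Bredon

variable {G : Type u} [Group G] {𝓗 : ClassOfSubgroups G} {r : Rank 𝓗} {R : Type u} [CommRing R]

section Boundary

variable {L : Subgroup G} {n : ℕ}

/-- Minus the alternating sum of the faces of a chain whose ranks are in `I`. -/
noncomputable def flagBoundary (I : Set ℕ) (c : Flag 𝓗 L (n + 1)) : Layer r I L n →₀ R :=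
  -- With this global sign the face that omits member `i.succ` has sign (-1)^i, as in `boundary`
  -- after the smallest member is split off.
  -∑ i : Fin (n + 2), (-1 : R) ^ (i : ℕ) • restrict R I (c.face i)

theorem flagBoundary_eq_zero {I : Set ℕ} (c : Flag 𝓗 L (n + 1))
    (h : ∀ b ∈ I, ¬ c.rank r ≤ b) : (flagBoundary I c : Layer r I L n →₀ R) = 0 := by
  refine neg_eq_zero.2 (Finset.sum_eq_zero fun i _ => ?_)
  rw [restrict_of_notMem fun hi => h _ hi (c.rank_le_rank_face r i), smul_zero]

/-- Omitting the same two members in the opposite order gives the same chain with the opposite sign.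
-/
theorem sum_flagBoundary_face (I : Set ℕ) (c : Flag 𝓗 L (n + 2)) :
    ∑ i : Fin (n + 3), (-1 : R) ^ (i : ℕ) •
      (flagBoundary I (c.face i) : Layer r I L n →₀ R) = 0 := by
  simp only [flagBoundary, smul_neg, Finset.sum_neg_distrib, neg_eq_zero, Finset.smul_sum,
    smul_smul]
  rw [← Finset.sum_product', Finset.univ_product_univ]
  refine Finset.sum_involution (fun p _ => (p.1.succAbove p.2, p.2.predAbove p.1)) ?_ ?_ ?_ ?_
  · rintro ⟨i, j⟩ -
    dsimp only
    rw [Flag.face_face, ← pow_add, ← pow_add, Fin.neg_one_pow_succAbove_add_predAbove, neg_smul,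
      add_neg_cancel]
  · rintro ⟨i, j⟩ - - h
    exact Fin.succAbove_ne i j (congrArg Prod.fst h)
  · intros
    exact Finset.mem_univ _
  · rintro ⟨i, j⟩ -
    simp [Fin.succAbove_succAbove_predAbove, Fin.predAbove_predAbove_succAbove]

end Boundary

variable (r R)

/-- The boundary of `layerModule`. -/
noncomputable def layerBoundary (I : Set ℕ) (n : ℕ) :
    layerModule r R I (n + 1) ⟶ layerModule r R I n :=
  layerModuleDesc r R (fun _ c => flagBoundary I c) fun L L' g c _ => by
    refine (map_neg _ _).trans (congrArg Neg.neg ?_)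
    refine (map_sum _ _ _).trans (Finset.sum_congr rfl fun i _ => ?_)
    refine (map_smul _ _ _).trans (congrArg _ ?_)
    exact layerModule_map_restrict r R g _

variable {r R}

theorem layerBoundary_restrict {I : Set ℕ} {n : ℕ} {L : Orb 𝓗} (c : Flag 𝓗 L.sub (n + 1))
    (hc : c.rank r ∉ I → ∀ b ∈ I, ¬ c.rank r ≤ b) :
    ((layerBoundary r R I n).app (Opposite.op L)).hom (restrict R I c) = flagBoundary I c :=
  layerDesc_restrict_of_imp _ fun h => flagBoundary_eq_zero c (hc h)

/-- Ranks only go up along faces, so if `I` is convex above `c`, a face discarded for leaving `I`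
has no faces of its own in `I`. The truncated boundary then squares to zero like the full one. -/
theorem layerBoundary_flagBoundary {I : Set ℕ} {n : ℕ} {L : Orb 𝓗} (c : Flag 𝓗 L.sub (n + 2))
    (hc : ∀ b ∈ I, ∀ a, c.rank r ≤ a → a ≤ b → a ∈ I) :
    ((layerBoundary r R I n).app (Opposite.op L)).hom (flagBoundary I c) = 0 := by
  refine (map_neg _ _).trans (neg_eq_zero.2 ((map_sum _ _ _).trans ?_))
  refine Eq.trans ?_ (sum_flagBoundary_face (R := R) (r := r) I c)
  refine Finset.sum_congr rfl fun i _ => (map_smul _ _ _).trans (congrArg _ ?_)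
  exact layerBoundary_restrict _ fun h b hb hb' => h (hc b hb _ (c.rank_le_rank_face r i) hb')

variable (r R) in
/-- The complex of chains whose smallest member has rank in `I`. -/
noncomputable def layerComplex (I : Set ℕ) (hI : I.OrdConnected) :
    ChainComplex (Contramodule R 𝓗) ℕ :=
  ChainComplex.of (layerModule r R I) (layerBoundary r R I) fun n => by
    refine layerModule_hom_ext fun L c hc => ?_
    refine (congrArg ((layerBoundary r R I n).app (Opposite.op L)).hom
      (layerBoundary_restrict c fun h => absurd hc h)).trans ?_
    exact layerBoundary_flagBoundary c fun b hb a ha hab => hI.out hc hb ⟨ha, hab⟩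

theorem layerComplex_d (I : Set ℕ) (hI : I.OrdConnected) (n : ℕ) :
    (layerComplex r R I hI).d (n + 1) n = layerBoundary r R I n :=
  ChainComplex.of_d _ _ _

section Change

variable (r R)

/-- Discard the chains whose ranks are not in `J`. -/
noncomputable def layerChange (I J : Set ℕ) (n : ℕ) : layerModule r R I n ⟶ layerModule r R J n :=
  layerModuleDesc r R (fun _ c => restrict R J c) fun _ _ g c _ =>
    layerModule_map_restrict r R g c

variable {r R}

theorem layerChange_restrict {I J : Set ℕ} {n : ℕ} {L : Orb 𝓗} (c : Flag 𝓗 L.sub n)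
    (hc : c.rank r ∈ J → c.rank r ∈ I) :
    ((layerChange r R I J n).app (Opposite.op L)).hom (restrict R I c) = restrict R J c :=
  layerDesc_restrict_of_imp _ fun h => restrict_of_notMem (mt hc h)

/-- Here `a` is the rank of a chain and `b` that of one of its faces. The condition covers both the
inclusion of the higher ranks and the projection to the lowest one. -/
theorem layerChange_layerBoundary {I J : Set ℕ} (h : ∀ a ∈ I, ∀ b ∈ J, a ≤ b → a ∈ J ∧ b ∈ I)
    (n : ℕ) : layerChange r R I J (n + 1) ≫ layerBoundary r R J n =
      layerBoundary r R I n ≫ layerChange r R I J n := by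
  refine layerModule_hom_ext fun L c hc => ?_
  refine (congrArg ((layerBoundary r R J n).app (Opposite.op L)).hom
    (layerChange_restrict c fun _ => hc)).trans ?_
  refine (layerBoundary_restrict c fun h' b hb hb' => h' (h _ hc b hb hb').1).trans ?_
  symm
  refine (congrArg ((layerChange r R I J n).app (Opposite.op L)).hom
    (layerBoundary_restrict c fun h => absurd hc h)).trans ?_
  refine (map_neg _ _).trans (congrArg Neg.neg ?_)
  refine (map_sum _ _ _).trans (Finset.sum_congr rfl fun i _ => ?_)
  refine (map_smul _ _ _).trans (congrArg _ (layerChange_restrict _ fun hi => ?_))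
  exact (h _ hc _ hi (c.rank_le_rank_face r i)).2

variable (r R) in
/-- Discard the chains whose ranks are not in `J`, as a map of complexes. -/
noncomputable def layerComplexChange {I J : Set ℕ} (hI : I.OrdConnected) (hJ : J.OrdConnected)
    (h : ∀ a ∈ I, ∀ b ∈ J, a ≤ b → a ∈ J ∧ b ∈ I) :
    layerComplex r R I hI ⟶ layerComplex r R J hJ :=
  ChainComplex.homMk (layerChange r R I J) fun n => by
    rw [layerComplex_d, layerComplex_d]
    exact layerChange_layerBoundary h n

end Change

section Filtration

variable (r R)

/-- The complex of chains whose smallest member has rank at least `k`. -/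
noncomputable abbrev upperComplex (k : ℕ) : ChainComplex (Contramodule R 𝓗) ℕ :=
  layerComplex r R (Set.Ici k) Set.ordConnected_Ici

/-- The complex of chains whose smallest member has rank `k`. -/
noncomputable abbrev gradedComplex (k : ℕ) : ChainComplex (Contramodule R 𝓗) ℕ :=
  layerComplex r R {k} Set.ordConnected_singleton

/-- The inclusion of the chains of rank greater than `k`. -/
noncomputable def upperInclusion (k : ℕ) : upperComplex r R (k + 1) ⟶ upperComplex r R k :=
  layerComplexChange r R _ _ fun _ ha _ _ hab =>
    ⟨(Nat.le_succ k).trans ha, (Set.mem_Ici.1 ha).trans hab⟩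

/-- The projection to the chains of rank `k`. -/
noncomputable def upperProjection (k : ℕ) : upperComplex r R k ⟶ gradedComplex r R k :=
  layerComplexChange r R _ _ fun a ha b hb hab => by
    obtain rfl : b = k := hb
    exact ⟨le_antisymm hab ha, Set.self_mem_Ici⟩

theorem layerChange_comp_eq_zero (k n : ℕ) :
    layerChange r R (Set.Ici (k + 1)) (Set.Ici k) n ≫ layerChange r R (Set.Ici k) {k} n = 0 := by
  refine layerModule_hom_ext fun L c hc => ?_
  have hc' : k < c.rank r := hc
  refine (congrArg ((layerChange r R (Set.Ici k) {k} n).app (Opposite.op L)).hom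
    (layerChange_restrict c fun _ => hc)).trans ?_
  refine (layerChange_restrict c fun _ => hc'.le).trans ?_
  exact restrict_of_notMem hc'.ne'

theorem upperInclusion_comp (k : ℕ) : upperInclusion r R k ≫ upperProjection r R k = 0 := by
  ext n : 1
  exact layerChange_comp_eq_zero r R k n

/-- The splitting of the filtration step, which is not natural in the orbit. -/
noncomputable def layerSplitting (k n : ℕ) (L : (Orb 𝓗)ᵒᵖ) :
    ((ShortComplex.mk _ _ (layerChange_comp_eq_zero r R k n)).map
      ((evaluation (Orb 𝓗)ᵒᵖ (ModuleCat.{u} R)).obj L)).Splitting where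
  r := (layerChange r R (Set.Ici k) (Set.Ici (k + 1)) n).app L
  s := (layerChange r R {k} (Set.Ici k) n).app L
  f_r := by
    apply ModuleCat.hom_ext
    refine layer_linearMap_ext fun c hc => ?_
    refine (congrArg ((layerChange r R (Set.Ici k) (Set.Ici (k + 1)) n).app L).hom
      (layerChange_restrict (L := L.unop) c fun _ => hc)).trans ?_
    exact layerChange_restrict (L := L.unop) c fun _ => (Nat.le_succ k).trans hc
  s_g := by
    apply ModuleCat.hom_ext
    refine layer_linearMap_ext fun c hc => ?_
    refine (congrArg ((layerChange r R (Set.Ici k) {k} n).app L).hom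
      (layerChange_restrict (L := L.unop) c fun _ => hc)).trans ?_
    exact layerChange_restrict (L := L.unop) c fun _ => (Set.mem_singleton_iff.1 hc).ge
  id := by
    apply ModuleCat.hom_ext
    refine layer_linearMap_ext fun c hc => ?_
    have h₁ : ((layerChange r R (Set.Ici k) (Set.Ici (k + 1)) n).app L).hom
        (restrict R (Set.Ici k) c) = restrict R (Set.Ici (k + 1)) c :=
      layerChange_restrict (L := L.unop) c fun _ => hc
    have h₂ : ((layerChange r R (Set.Ici k) {k} n).app L).hom
        (restrict R (Set.Ici k) c) = restrict R {k} c :=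
      layerChange_restrict (L := L.unop) c fun _ => hc
    have h₃ : ((layerChange r R (Set.Ici (k + 1)) (Set.Ici k) n).app L).hom
        (restrict R (Set.Ici (k + 1)) c) + ((layerChange r R {k} (Set.Ici k) n).app L).hom
        (restrict R {k} c) = restrict R (Set.Ici k) c := by
      rcases (Set.mem_Ici.1 hc).eq_or_lt with h | h
      · rw [restrict_of_notMem (I := Set.Ici (k + 1)) (by
          simp [← h])]
        refine (congrArg (· + _) (map_zero _)).trans ((zero_add _).trans ?_)
        exact layerChange_restrict (L := L.unop) c fun _ => h.symm
      · rw [restrict_of_notMem (I := {k}) h.ne']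
        refine (congrArg (_ + ·) (map_zero _)).trans ((add_zero _).trans ?_)
        exact layerChange_restrict (L := L.unop) c fun _ => h
    refine Eq.trans ?_ h₃
    exact congrArg₂ (· + ·)
      (congrArg ((layerChange r R (Set.Ici (k + 1)) (Set.Ici k) n).app L).hom h₁)
      (congrArg ((layerChange r R {k} (Set.Ici k) n).app L).hom h₂)

theorem upper_shortExact (k : ℕ) :
    (ShortComplex.mk _ _ (upperInclusion_comp r R k)).ShortExact :=
  HomologicalComplex.shortExact_of_degreewise_shortExact _ fun n =>
    ShortComplex.shortExact_of_evaluation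
      (ShortComplex.mk _ _ (layerChange_comp_eq_zero r R k n)) fun L =>
        (layerSplitting r R k n L).shortExact

theorem upperComplex_acyclic (b : ℕ) (hb : ∀ K ∈ 𝓗.carrier, r.toFun K < b) :
    (upperComplex r R b).Acyclic := by
  intro n
  refine (HomologicalComplex.exactAt_iff_isZero_homology _ _).2 ?_
  have h : IsZero ((upperComplex r R b).X n) := Functor.isZero _ fun L => by
    have : IsEmpty (Layer r (Set.Ici b) L.unop.sub n) :=
      ⟨fun c => (hb _ (c.1.2.2.1 0)).not_ge c.2⟩
    exact @ModuleCat.isZero_of_subsingleton R _ (ModuleCat.of R _) (Finsupp.uniqueOfLeft.instSubsingleton)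
  exact ShortComplex.isZero_homology_of_isZero_X₂ _ h

end Filtration

end Bredon

/-! ### The flag complex resolves the trivial contramodule -/

theorem CategoryTheory.ShortComplex.exact_of_evaluation {D C : Type*} [Category* D]
    [Category* C] [Abelian C] (S : ShortComplex (D ⥤ C))
    (h : ∀ X, (S.map ((evaluation D C).obj X)).Exact) : S.Exact :=
  S.exact_iff_isZero_homology.2 <| Functor.isZero _ fun X =>
    (((S.map ((evaluation D C).obj X)).exact_iff_isZero_homology).1 (h X)).of_iso
      (S.mapHomologyIso ((evaluation D C).obj X)).symm

theorem CategoryTheory.ShortComplex.Exact.of_eq {C : Type*} [Category* C] [HasZeroMorphisms C]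
    {X Y Z : C} {f f' : X ⟶ Y} {g g' : Y ⟶ Z} {w : f ≫ g = 0} (h : (ShortComplex.mk f g w).Exact)
    (hf : f = f') (hg : g = g') (w' : f' ≫ g' = 0) : (ShortComplex.mk f' g' w').Exact := by
  subst hf hg
  exact h

theorem ChainComplex.quasiIso_toSingle₀_of_exact {C : Type*} [Category* C] [Abelian C]
    {K : ChainComplex C ℕ} {Z : C} (f : K ⟶ (single₀ C).obj Z) (hK : ∀ n, K.ExactAt (n + 1))
    (w : K.d 1 0 ≫ f.f 0 = 0) [Epi (f.f 0)]
    (h : (ShortComplex.mk (K.d 1 0) (f.f 0) w).Exact) : QuasiIso f where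
  quasiIsoAt n := by
    cases n with
    | zero =>
      rw [ChainComplex.quasiIsoAt₀_iff, ShortComplex.quasiIso_iff_of_zeros']
      · refine (ShortComplex.exact_and_epi_g_iff_of_iso ?_).2
          ⟨h, inferInstanceAs (Epi (f.f 0))⟩
        exact ShortComplex.isoMk (Iso.refl _) (Iso.refl _) (Iso.refl _)
          ((Category.id_comp _).trans (Category.comp_id _).symm)
          ((Category.id_comp _).trans (Category.comp_id _).symm)
      · exact K.shape _ _ (by simp)
      · rfl
      · rfl
    | succ n =>
      exact (quasiIsoAt_iff_exactAt' _ _ (ChainComplex.exactAt_succ_single_obj _ _)).2 (hK n)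

namespace Bredon

variable {G : Type u} [Group G] {𝓗 : ClassOfSubgroups G}

namespace Flag

variable {L K : Subgroup G}

theorem face_succ_cons (hK : K ∈ 𝓗.carrier) (hL : L ≤ K) {n : ℕ} (c : Fin (n + 1) → Subgroup G)
    (hc : StrictMono c) (hc' : ∀ i, c i ∈ 𝓗.carrier) (hlt : ∀ i, K < c i) (i : Fin (n + 1)) :
    (cons hK hL c hc hc' hlt).face i.succ = cons hK hL (fun j => c (i.succAbove j))
      (hc.comp (Fin.strictMono_succAbove i)) (fun _ => hc' _) (fun _ => hlt _) := by
  refine ext fun j => ?_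
  induction j using Fin.cases with
  | zero => exact congrArg (Fin.cons K c : Fin (n + 2) → Subgroup G) (Fin.succ_succAbove_zero i)
  | succ j =>
    exact congrArg (Fin.cons K c : Fin (n + 2) → Subgroup G) (Fin.succ_succAbove_succ i j)

/-- Prepend `L` to a chain of subgroups strictly containing `L`. -/
def prepend (hL : L ∈ 𝓗.carrier) {n : ℕ} (c : Flag 𝓗 L n) (h : L < c.1 0) : Flag 𝓗 L (n + 1) :=
  cons hL le_rfl c.1 c.2.1 c.2.2.1 fun i => h.trans_le (c.2.1.monotone (Fin.zero_le i))

theorem face_zero_prepend (hL : L ∈ 𝓗.carrier) {n : ℕ} (c : Flag 𝓗 L n) (h : L < c.1 0) :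
    (c.prepend hL h).face 0 = c :=
  ext fun _ => rfl

theorem face_succ_prepend (hL : L ∈ 𝓗.carrier) {n : ℕ} (c : Flag 𝓗 L (n + 1)) (h : L < c.1 0)
    (i : Fin (n + 2)) : (c.prepend hL h).face i.succ =
      (c.face i).prepend hL (h.trans_le (c.zero_le_face_zero i)) :=
  face_succ_cons ..

theorem prepend_face_zero (hL : L ∈ 𝓗.carrier) {n : ℕ} (c : Flag 𝓗 L (n + 1)) (h : L = c.1 0) :
    (c.face 0).prepend hL (h.trans_lt c.lt_face_zero_zero) = c := by
  refine ext fun j => ?_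
  induction j using Fin.cases with
  | zero => exact h
  | succ j => exact congrArg c.1 (Fin.zero_succAbove j)

/-- The chain consisting of `L` only. -/
def bot (hL : L ∈ 𝓗.carrier) : Flag 𝓗 L 0 :=
  cons hL le_rfl Fin.elim0 (fun i => i.elim0) (fun i => i.elim0) (fun i => i.elim0)

theorem eq_bot (hL : L ∈ 𝓗.carrier) (c : Flag 𝓗 L 0) (h : L = c.1 0) : bot hL = c :=
  ext fun i => by
    obtain rfl := Fin.fin_one_eq_zero i
    exact h

theorem face_one_prepend (hL : L ∈ 𝓗.carrier) (c : Flag 𝓗 L 0) (h : L < c.1 0) :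
    (c.prepend hL h).face 1 = bot hL :=
  ext fun i => by
    obtain rfl := Fin.fin_one_eq_zero i
    rfl

end Flag

variable {r : Rank 𝓗} {R : Type u} [CommRing R]

section Contraction

variable {L : Subgroup G} (hL : L ∈ 𝓗.carrier)

open Classical in
/-- The value of the contracting homotopy on a chain. -/
noncomputable def flagContraction {n : ℕ} (c : Flag 𝓗 L n) :
    Layer r (Set.Ici 0) L (n + 1) →₀ R :=
  -- The sign cancels the one in `flagBoundary`; a chain that already starts with `L` cannot be
  -- extended by it.
  if h : L < c.1 0 then -restrict R _ (c.prepend hL h) else 0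

variable (r R) in
/-- The contracting homotopy of the complex of all chains. -/
noncomputable def contraction (n : ℕ) :
    (Layer r (Set.Ici 0) L n →₀ R) →ₗ[R] (Layer r (Set.Ici 0) L (n + 1) →₀ R) :=
  layerDesc _ (flagContraction hL)

theorem contraction_of_lt {n : ℕ} (c : Flag 𝓗 L n) (h : L < c.1 0) :
    contraction r R hL n (restrict R _ c) = -restrict R _ (c.prepend hL h) :=
  (layerDesc_restrict _ (Nat.zero_le _)).trans (dif_pos h)

theorem contraction_of_eq {n : ℕ} (c : Flag 𝓗 L n) (h : L = c.1 0) :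
    contraction r R hL n (restrict R _ c) = 0 :=
  (layerDesc_restrict _ (Nat.zero_le _)).trans (dif_neg h.not_lt)

theorem layerDesc_flagBoundary {n : ℕ} (c : Flag 𝓗 L (n + 1)) :
    layerDesc (r := r) (Set.Ici 0) (flagBoundary (R := R) (Set.Ici 0)) (restrict R _ c) =
      (flagBoundary _ c : Layer r (Set.Ici 0) L n →₀ R) :=
  layerDesc_restrict _ (Set.mem_Ici.2 (Nat.zero_le _))

/-- The poset of members of 𝓗 containing `L` is a cone with apex `L`. If a chain starts with `L`,
only its zeroth face survives the contraction, and prepending `L` restores the chain. Otherwise the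
zeroth face of the prolonged chain is the chain itself, and the remaining faces cancel against the
contracted boundary. -/
theorem contraction_homotopy (n : ℕ) :
    layerDesc (Set.Ici 0) (flagBoundary (R := R) (Set.Ici 0)) ∘ₗ contraction r R hL (n + 1) +
      contraction r R hL n ∘ₗ layerDesc (Set.Ici 0) (flagBoundary (Set.Ici 0)) =
        LinearMap.id := by
  refine layer_linearMap_ext fun c _ => ?_
  simp only [LinearMap.add_apply, LinearMap.comp_apply, LinearMap.id_apply]
  rw [layerDesc_flagBoundary]
  rcases (show L ≤ c.1 0 from c.le 0).eq_or_lt with h | h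
  · rw [contraction_of_eq hL c h, map_zero, zero_add, flagBoundary, map_neg, map_sum,
      Fin.sum_univ_succ, Finset.sum_eq_zero, add_zero, Fin.val_zero, pow_zero, one_smul,
      contraction_of_lt hL _ (h.trans_lt c.lt_face_zero_zero), Flag.prepend_face_zero hL c h,
      neg_neg]
    intro i _
    rw [map_smul, contraction_of_eq hL _ (h.trans (c.face_succ_zero i).symm), smul_zero]
  · rw [contraction_of_lt hL c h, map_neg, layerDesc_flagBoundary, flagBoundary, neg_neg,
      Fin.sum_univ_succ, Fin.val_zero, pow_zero, one_smul, Flag.face_zero_prepend, flagBoundary,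
      map_neg, map_sum, add_assoc, add_eq_left, ← sub_eq_add_neg, sub_eq_zero]
    refine Finset.sum_congr rfl fun i _ => ?_
    rw [map_smul, contraction_of_lt hL _ (h.trans_le (c.zero_le_face_zero i)),
      Flag.face_succ_prepend, smul_neg, Fin.val_succ, pow_succ, mul_neg_one, neg_smul]

/-- In degree 0 the face of L < K₀ that omits K₀ is the chain consisting of `L` alone; the
augmentation accounts for it. -/
theorem contraction_homotopy_zero :
    layerDesc (Set.Ici 0) (flagBoundary (R := R) (Set.Ici 0)) ∘ₗ contraction r R hL 0 +
      LinearMap.toSpanSingleton R _ (restrict R _ (Flag.bot hL)) ∘ₗ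
        layerDesc (Set.Ici 0) (fun _ => (1 : R)) = LinearMap.id := by
  refine layer_linearMap_ext fun c hc => ?_
  simp only [LinearMap.add_apply, LinearMap.comp_apply, LinearMap.id_apply]
  rw [layerDesc_restrict _ hc, LinearMap.toSpanSingleton_apply, one_smul]
  rcases (show L ≤ c.1 0 from c.le 0).eq_or_lt with h | h
  · rw [contraction_of_eq hL c h, map_zero, zero_add, Flag.eq_bot hL c h]
  · rw [contraction_of_lt hL c h, map_neg, layerDesc_flagBoundary, flagBoundary, neg_neg,
      Fin.sum_univ_two, Flag.face_zero_prepend, Flag.face_one_prepend]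
    simp

theorem exists_layerDesc_flagBoundary_eq (hL : L ∈ 𝓗.carrier) {n : ℕ}
    {x : Layer r (Set.Ici 0) L (n + 1) →₀ R}
    (hx : layerDesc (Set.Ici 0) (flagBoundary (Set.Ici 0)) x =
      (0 : Layer r (Set.Ici 0) L n →₀ R)) :
    ∃ y : Layer r (Set.Ici 0) L (n + 2) →₀ R,
      layerDesc (Set.Ici 0) (flagBoundary (Set.Ici 0)) y = x := by
  refine ⟨contraction r R hL (n + 1) x, ?_⟩
  have h := LinearMap.congr_fun (contraction_homotopy (r := r) (R := R) hL n) x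
  rwa [LinearMap.add_apply, LinearMap.comp_apply, LinearMap.comp_apply, hx, map_zero,
    add_zero] at h

theorem exists_layerDesc_flagBoundary_eq_zero (hL : L ∈ 𝓗.carrier)
    {x : Layer r (Set.Ici 0) L 0 →₀ R}
    (hx : layerDesc (Set.Ici 0) (fun _ => (1 : R)) x = 0) :
    ∃ y : Layer r (Set.Ici 0) L 1 →₀ R,
      layerDesc (Set.Ici 0) (flagBoundary (Set.Ici 0)) y = x := by
  refine ⟨contraction r R hL 0 x, ?_⟩
  have h := LinearMap.congr_fun (contraction_homotopy_zero (r := r) (R := R) hL) x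
  rwa [LinearMap.add_apply, LinearMap.comp_apply, LinearMap.comp_apply, hx, map_zero,
    add_zero] at h

end Contraction

variable (r R)

/-- The augmentation of the complex of all chains, in degree zero. -/
noncomputable def augmentation : layerModule r R (Set.Ici 0) 0 ⟶ trivialContramodule R 𝓗 :=
  layerModuleDesc r R (fun _ _ => (1 : R)) fun _ _ _ _ _ => rfl

theorem augmentation_restrict {L : Orb 𝓗} (c : Flag 𝓗 L.sub 0) :
    ((augmentation r R).app (Opposite.op L)).hom (restrict R _ c) = (1 : R) :=
  layerDesc_restrict _ (Nat.zero_le _)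

theorem layerBoundary_comp_augmentation :
    layerBoundary r R (Set.Ici 0) 0 ≫ augmentation r R = 0 := by
  refine layerModule_hom_ext fun L c hc => ?_
  refine (congrArg ((augmentation r R).app (Opposite.op L)).hom
    (layerBoundary_restrict c fun h => absurd hc h)).trans ?_
  refine (map_neg _ _).trans (neg_eq_zero.2 ?_)
  refine (map_sum _ _ _).trans ((Fin.sum_univ_two _).trans ?_)
  refine (congrArg₂ (· + ·)
    ((map_smul _ _ _).trans (congrArg _ (augmentation_restrict r R (c.face 0))))
    ((map_smul _ _ _).trans (congrArg _ (augmentation_restrict r R (c.face 1))))).trans ?_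
  change ((-1 : R) ^ 0) * 1 + ((-1 : R) ^ 1) * 1 = 0
  simp

theorem augmentation_exact :
    (ShortComplex.mk _ _ (layerBoundary_comp_augmentation r R)).Exact :=
  ShortComplex.exact_of_evaluation _ fun L => by
    rw [ShortComplex.moduleCat_exact_iff]
    intro x hx
    exact exists_layerDesc_flagBoundary_eq_zero L.unop.mem hx

instance epi_augmentation : Epi (augmentation r R) := by
  have (L : (Orb 𝓗)ᵒᵖ) : Epi ((augmentation r R).app L) := by
    rw [ModuleCat.epi_iff_surjective]
    intro (x : R)
    refine ⟨x • restrict R _ (Flag.bot L.unop.mem), (map_smul _ _ _).trans ?_⟩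
    refine (congrArg (x • ·) (augmentation_restrict (L := L.unop) r R _)).trans ?_
    exact mul_one x
  exact NatTrans.epi_of_epi_app _

theorem layerBoundary_comp (n : ℕ) :
    layerBoundary r R (Set.Ici 0) (n + 1) ≫ layerBoundary r R (Set.Ici 0) n = 0 := by
  rw [← layerComplex_d _ Set.ordConnected_Ici, ← layerComplex_d _ Set.ordConnected_Ici]
  exact HomologicalComplex.d_comp_d _ _ _ _

theorem upperComplex_zero_exactAt (n : ℕ) : (upperComplex r R 0).ExactAt (n + 1) := by
  rw [HomologicalComplex.exactAt_iff' _ (n + 2) (n + 1) n (by simp) (by simp)]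
  have h : (ShortComplex.mk _ _ (layerBoundary_comp r R n)).Exact :=
    ShortComplex.exact_of_evaluation _ fun L => by
      rw [ShortComplex.moduleCat_exact_iff]
      intro x hx
      exact exists_layerDesc_flagBoundary_eq L.unop.mem hx
  exact h.of_eq (layerComplex_d _ _ _).symm (layerComplex_d _ _ _).symm _

/-- The augmentation of the complex of all chains. -/
noncomputable def upperAugmentation :
    upperComplex r R 0 ⟶ (ChainComplex.single₀ _).obj (trivialContramodule R 𝓗) :=
  (ChainComplex.toSingle₀Equiv _ _).symm ⟨augmentation r R, by
    rw [layerComplex_d]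
    exact layerBoundary_comp_augmentation r R⟩

theorem quasiIso_upperAugmentation : QuasiIso (upperAugmentation r R) := by
  have h : (upperAugmentation r R).f 0 = augmentation r R :=
    ChainComplex.toSingle₀Equiv_symm_apply_f_zero _ _
  have w : (upperComplex r R 0).d 1 0 ≫ (upperAugmentation r R).f 0 = 0 := by
    rw [h, layerComplex_d]
    exact layerBoundary_comp_augmentation r R
  have : Epi ((upperAugmentation r R).f 0) := by
    rw [h]
    exact epi_augmentation r R
  refine ChainComplex.quasiIso_toSingle₀_of_exact _ (upperComplex_zero_exactAt r R) w ?_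
  exact (augmentation_exact r R).of_eq (layerComplex_d _ Set.ordConnected_Ici _).symm h.symm _

end Bredon

/-! ### The layers as complexes induced from Σ𝓗̃_H -/

namespace Bredon

variable {G : Type u} [Group G] {𝓗 : ClassOfSubgroups G} {R : Type u} [CommRing R]

/-! The basis of `Σ 𝓗̃_H`. -/

section Basis

variable {H : Subgroup G} {n : ℕ}

variable (R) in
/-- A chain as an element of `Σ 𝓗̃_H`. -/
noncomputable def chainElt (s : Chains 𝓗 H n) : (suspAugChains R 𝓗 H).X n :=
  (Finsupp.single s 1 : Chains 𝓗 H n →₀ R)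

theorem rho_chainElt (w : Weyl H) (s : Chains 𝓗 H n) :
    ((suspAugChains R 𝓗 H).X n).ρ w (chainElt R s) = chainElt R (w • s) :=
  Finsupp.mapDomain_single

variable (R) in
theorem suspAugChains_d :
    ((suspAugChains R 𝓗 H).d (n + 1) n).hom.toLinearMap = boundary R 𝓗 H n := by
  delta suspAugChains
  dsimp only
  rw [ChainComplex.of_d]
  rfl

theorem d_chainElt (s : Chains 𝓗 H (n + 1)) :
    ((suspAugChains R 𝓗 H).d (n + 1) n).hom (chainElt R s) =
      ∑ i : Fin (n + 1), (-1 : R) ^ (i : ℕ) • chainElt R (face i s) := by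
  exact (LinearMap.congr_fun (suspAugChains_d R) (chainElt R s)).trans (boundary_single R 𝓗 H n s)

theorem chain_linearMap_ext {M : Type*} [AddCommGroup M] [Module R M]
    {f g : (suspAugChains R 𝓗 H).X n →ₗ[R] M}
    (h : ∀ s : Chains 𝓗 H n, f (chainElt R s) = g (chainElt R s)) : f = g :=
  Finsupp.lhom_ext' (M := R) fun s => LinearMap.ext_ring (h s)

/-- The linear map on `Σ 𝓗̃_H` with given values on chains. -/
noncomputable def chainDesc {M : Type*} [AddCommGroup M] [Module R M] (f : Chains 𝓗 H n → M) :
    (suspAugChains R 𝓗 H).X n →ₗ[R] M :=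
  Finsupp.linearCombination R f

theorem chainDesc_chainElt {M : Type*} [AddCommGroup M] [Module R M] (f : Chains 𝓗 H n → M)
    (s : Chains 𝓗 H n) : chainDesc f (chainElt R s) = f s :=
  (Finsupp.linearCombination_single R _ _).trans (one_smul _ _)

end Basis

/-! Chains above `H` as chains starting with `H`. -/

namespace Flag

/-- Prepend `H` to a chain in `𝓗_H`. -/
def ofChain (H : Orb 𝓗) {n : ℕ} (s : Chains 𝓗 H.sub n) : Flag 𝓗 H.sub n :=
  cons H.mem le_rfl (fun i => (s.1 i).1) (fun _ _ h => s.2 h) (fun i => (s.1 i).2.1)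
    fun i => (s.1 i).2.2

theorem face_succ_ofChain (H : Orb 𝓗) {n : ℕ} (s : Chains 𝓗 H.sub (n + 1)) (i : Fin (n + 1)) :
    (ofChain H s).face i.succ = ofChain H (Bredon.face i s) :=
  face_succ_cons ..

/-- The map `w • 𝟙 H` is right translation by an inverse representative of `w`, so conjugation along
it undoes the action of `w` on the chain. This compatibility lets `gradedValue` descend to the
tensor product over `WH`. -/
theorem res_weyl_smul_id {H : Orb 𝓗} {n : ℕ} (w : Weyl H.sub) (s : Chains 𝓗 H.sub n) :
    (ofChain H (w • s)).res (w • 𝟙 H) = ofChain H s := by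
  induction w using QuotientGroup.induction_on with
  | H x =>
    have h : ((homRep ((x : Weyl H.sub) • 𝟙 H) : G) : G ⧸ H.sub) =
        (((x : G)⁻¹ : G) : G ⧸ H.sub) := by
      rw [mk_homRep]
      exact congrArg QuotientGroup.mk (one_mul _)
    refine ext fun i => ?_
    refine (conj_smul_eq_of_mk_eq (Flag.le _ i) h).trans ?_
    induction i using Fin.cases with
    | zero => exact conj_smul_self_of_mem_normalizer (inv_mem x.2)
    | succ i =>
      change MulAut.conj (x : G)⁻¹ • MulAut.conj (x : G) • (s.1 i).1 = (s.1 i).1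
      rw [map_inv, inv_smul_smul]

/-- Two presentations of a chain by representatives of conjugacy classes are related by the
action of the Weyl group. -/
theorem exists_weyl_smul {L H : Orb 𝓗} {n : ℕ} {f f' : L ⟶ H} {s s' : Chains 𝓗 H.sub n}
    (h : (ofChain H s).res f = (ofChain H s').res f') :
    ∃ w : Weyl H.sub, w • f' = f ∧ w • s' = s := by
  have h' (i : Fin (n + 1)) : MulAut.conj (homRep f) • (ofChain H s).1 i =
      MulAut.conj (homRep f') • (ofChain H s').1 i := congrArg (fun c => c.1 i) h
  -- The smallest members are two conjugates of `H`. Their equality puts the quotient of the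
  -- conjugating elements in the normalizer, and its class is the required `w`.
  have h₀ : MulAut.conj ((homRep f)⁻¹ * homRep f') • H.sub = H.sub := by
    rw [map_mul, mul_smul, map_inv, inv_smul_eq_iff]
    exact (h' 0).symm
  have hx : (homRep f)⁻¹ * homRep f' ∈ Subgroup.normalizer (H.sub : Set G) := by
    rw [Subgroup.mem_normalizer_iff]
    intro y
    conv_rhs => rw [← h₀, Subgroup.mem_pointwise_smul_iff_inv_smul_mem, ← map_inv,
      MulAut.smul_def, MulAut.conj_apply]
    group
  refine ⟨QuotientGroup.mk ⟨_, hx⟩, ?_, ?_⟩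
  · refine hom_ext_of_homRep ?_
    rw [mk_homRep]
    change rightTranslation H.sub _ (Orb.toMap f' ((1 : G) : G ⧸ L.sub)) = _
    rw [← mk_homRep]
    refine congrArg QuotientGroup.mk ?_
    change homRep f' * ((homRep f)⁻¹ * homRep f')⁻¹ = homRep f
    group
  · refine Subtype.ext (funext fun i => Subtype.ext ?_)
    change MulAut.conj ((homRep f)⁻¹ * homRep f') • (s'.1 i).1 = (s.1 i).1
    rw [map_mul, mul_smul, map_inv, inv_smul_eq_iff]
    exact (h' i.succ).symm

/-- The smallest member of the common chain is conjugate to both representatives. -/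
theorem eq_of_res_eq {T : Set (Orb 𝓗)} (hT : IsSetOfRepresentatives T) {L : Orb 𝓗} {H H' : T}
    {n : ℕ} {f : L ⟶ H.1} {f' : L ⟶ H'.1} {s : Chains 𝓗 H.1.sub n} {s' : Chains 𝓗 H'.1.sub n}
    (h : (ofChain H.1 s).res f = (ofChain H'.1 s').res f') : H = H' := by
  obtain ⟨_, _, h₁⟩ := hT ⟨((ofChain H.1 s).res f).1 0, ((ofChain H.1 s).res f).2.2.1 0⟩
  refine Subtype.ext ((h₁ H.1 ⟨H.2, homRep f, rfl⟩).trans (h₁ H'.1 ⟨H'.2, homRep f', ?_⟩).symm)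
  exact (congrArg (fun c => c.1 0) h).symm

/-- Conjugate the chain so that its smallest member becomes a representative; the inclusion of `L`
in that member is what defines the map of orbits. -/
theorem exists_res_eq {T : Set (Orb 𝓗)} (hT : IsSetOfRepresentatives T) {L : Orb 𝓗} {n : ℕ}
    (c : Flag 𝓗 L.sub n) :
    ∃ (H : T) (f : L ⟶ H.1) (s : Chains 𝓗 H.1.sub n), (ofChain H.1 s).res f = c := by
  obtain ⟨H, ⟨hH, g, hg⟩, -⟩ := hT ⟨c.1 0, c.2.2.1 0⟩
  obtain ⟨f, hf⟩ := exists_hom_of_le_conj (L := L) (L' := H) g (hg ▸ c.2.2.2)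
  have hg' : H.sub = MulAut.conj g⁻¹ • c.1 0 := by
    rw [map_inv, eq_inv_smul_iff]
    exact hg
  refine ⟨⟨H, hH⟩, f, ⟨fun i => ⟨MulAut.conj g⁻¹ • c.1 i.succ, 𝓗.conj_mem _ (c.2.2.1 _), ?_⟩,
    fun i j h => conj_smul_lt _ (c.2.1 (Fin.succ_lt_succ_iff.2 h))⟩, ext fun i => ?_⟩
  · rw [hg']
    exact conj_smul_lt _ (c.2.1 (Fin.succ_pos i))
  · refine (conj_smul_eq_of_mk_eq (Flag.le _ i) hf).trans ?_
    induction i using Fin.cases with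
    | zero => exact hg
    | succ i =>
      change MulAut.conj g • MulAut.conj g⁻¹ • c.1 i.succ = c.1 i.succ
      rw [map_inv, smul_inv_smul]

end Flag

variable {r : Rank 𝓗}

section Graded

variable {k : ℕ} {H : Orb 𝓗}

/-- Prepend `H` to chains in `𝓗_H`. -/
noncomputable def gradedValue (k : ℕ) (H : Orb 𝓗) (n : ℕ) :
    (suspAugChains R 𝓗 H.sub).X n →ₗ[R] (layerModule r R {k} n).obj (Opposite.op H) :=
  chainDesc (M := Layer r {k} H.sub n →₀ R) fun s => restrict R {k} (Flag.ofChain H s)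

theorem gradedValue_chainElt (n : ℕ) (s : Chains 𝓗 H.sub n) :
    gradedValue (r := r) k H n (chainElt R s) = restrict R {k} (Flag.ofChain H s) :=
  chainDesc_chainElt (M := Layer r {k} H.sub n →₀ R) _ s

theorem gradedValue_equivariant (n : ℕ) (w : Weyl H.sub) (v : (suspAugChains R 𝓗 H.sub).X n) :
    ((layerModule r R {k} n).map (w • 𝟙 H).op).hom
      (gradedValue k H n (((suspAugChains R 𝓗 H.sub).X n).ρ w v)) = gradedValue k H n v := by
  refine LinearMap.congr_fun (f := ((layerModule r R {k} n).map (w • 𝟙 H).op).hom ∘ₗ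
    gradedValue k H n ∘ₗ ((suspAugChains R 𝓗 H.sub).X n).ρ w) (chain_linearMap_ext fun s => ?_) v
  refine (congrArg (fun v => ((layerModule r R {k} n).map (w • 𝟙 H).op).hom
    (gradedValue k H n v)) (rho_chainElt w s)).trans ?_
  refine (congrArg ((layerModule r R {k} n).map (w • 𝟙 H).op).hom
    (gradedValue_chainElt n _)).trans ?_
  refine (layerModule_map_restrict r R _ _).trans ?_
  rw [gradedValue_chainElt, Flag.res_weyl_smul_id]

/-- The zeroth face drops out because its rank exceeds `k`. The others omit members of the chain
above `H`, with sign -(-1)^(i+1) = (-1)^i. -/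
theorem gradedValue_d (hk : r.toFun H.sub = k) (n : ℕ)
    (v : (suspAugChains R 𝓗 H.sub).X (n + 1)) :
    gradedValue k H n (((suspAugChains R 𝓗 H.sub).d (n + 1) n).hom v) =
      ((layerBoundary r R {k} n).app (Opposite.op H)).hom (gradedValue k H (n + 1) v) := by
  refine LinearMap.congr_fun (f := gradedValue k H n ∘ₗ
    ((suspAugChains R 𝓗 H.sub).d (n + 1) n).hom.toLinearMap)
    (g := ((layerBoundary r R {k} n).app (Opposite.op H)).hom ∘ₗ gradedValue k H (n + 1))
    (chain_linearMap_ext fun s => ?_) v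
  refine (congrArg (gradedValue k H n) (d_chainElt s)).trans ?_
  symm
  refine (congrArg ((layerBoundary r R {k} n).app (Opposite.op H)).hom
    (gradedValue_chainElt (n + 1) s)).trans ?_
  have hc : (Flag.ofChain H s).rank r = k := hk
  refine (layerBoundary_restrict _ fun h => absurd hc h).trans ?_
  rw [flagBoundary, Fin.sum_univ_succ, restrict_of_notMem (I := {k})
    (hc ▸ ((Flag.ofChain H s).rank_lt_rank_face_zero r).ne'), smul_zero, zero_add]
  symm
  refine (map_sum _ _ _).trans ?_
  rw [← Finset.sum_neg_distrib]
  refine Finset.sum_congr rfl fun i _ => (map_smul _ _ _).trans ?_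
  rw [gradedValue_chainElt, Flag.face_succ_ofChain, Fin.val_succ, pow_succ, mul_neg_one]
  exact ((neg_smul _ _).symm.trans (congrArg (· • _) (neg_neg _))).symm

/-- The map from the complex induced from `Σ 𝓗̃_H` to the chains with smallest member conjugate
to `H`. -/
noncomputable def gradedMap (k : ℕ) (H : Orb 𝓗) (hk : r.toFun H.sub = k) :
    indComplex R H (suspAugChains R 𝓗 H.sub) ⟶ gradedComplex r R k :=
  ChainComplex.homMk (fun n => indDesc (gradedValue k H n) (gradedValue_equivariant n)) fun n => by
    rw [layerComplex_d]
    refine ind_hom_ext fun L f v => ?_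
    refine (congrArg ((layerBoundary r R {k} n).app (Opposite.op L)).hom
      (indDesc_app_indMk _ (gradedValue_equivariant (n + 1)) f v)).trans ?_
    have := congrArg ModuleCat.Hom.hom ((layerBoundary r R {k} n).naturality f.op)
    refine (LinearMap.congr_fun this (gradedValue k H (n + 1) v)).trans ?_
    refine (congrArg ((layerModule r R {k} n).map f.op).hom (gradedValue_d hk n v)).symm.trans ?_
    exact (indDesc_app_indMk _ (gradedValue_equivariant n) f
      (((suspAugChains R 𝓗 H.sub).d (n + 1) n).hom v)).symm

theorem gradedMap_indMk (hk : r.toFun H.sub = k) (n : ℕ) {L : Orb 𝓗} (f : L ⟶ H)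
    (s : Chains 𝓗 H.sub n) : (((gradedMap k H hk).f n).app (Opposite.op L)).hom
      (indMk ((suspAugChains R 𝓗 H.sub).X n) f (chainElt R s)) =
        restrict R {k} ((Flag.ofChain H s).res f) := by
  refine (indDesc_app_indMk _ (gradedValue_equivariant n) f _).trans ?_
  refine (congrArg ((layerModule r R {k} n).map f.op).hom (gradedValue_chainElt n s)).trans ?_
  exact layerModule_map_restrict r R _ _

theorem indMk_eq_of_res_eq {L : Orb 𝓗} {n : ℕ} {f f' : L ⟶ H} {s s' : Chains 𝓗 H.sub n}
    (h : (Flag.ofChain H s).res f = (Flag.ofChain H s').res f') :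
    indMk ((suspAugChains R 𝓗 H.sub).X n) f (chainElt R s) =
      indMk ((suspAugChains R 𝓗 H.sub).X n) f' (chainElt R s') := by
  obtain ⟨w, rfl, rfl⟩ := Flag.exists_weyl_smul h
  rw [← rho_chainElt, indMk_smul]

theorem ind_chains_hom_ext {n : ℕ} {M : Contramodule R 𝓗}
    {φ ψ : (ind R H).obj ((suspAugChains R 𝓗 H.sub).X n) ⟶ M}
    (h : ∀ (L : Orb 𝓗) (f : L ⟶ H) (s : Chains 𝓗 H.sub n),
      (φ.app (Opposite.op L)).hom (indMk _ f (chainElt R s)) =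
      (ψ.app (Opposite.op L)).hom (indMk _ f (chainElt R s))) : φ = ψ :=
  ind_hom_ext fun L f v => LinearMap.congr_fun
    (f := (φ.app (Opposite.op L)).hom ∘ₗ indMk ((suspAugChains R 𝓗 H.sub).X n) f)
    (g := (ψ.app (Opposite.op L)).hom ∘ₗ indMk ((suspAugChains R 𝓗 H.sub).X n) f)
    (chain_linearMap_ext (h L f)) v

end Graded

end Bredon

namespace Bredon

variable {G : Type u} [Group G] {𝓗 : ClassOfSubgroups G} {R : Type u} [CommRing R]

section GradedIso

variable (r : Rank 𝓗) (T : Set (Orb 𝓗)) (k : ℕ)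

/-- The representatives of rank `k`. -/
abbrev RankIndex : Type u := {H : T // r.toFun H.1.sub = k}

variable (R) in
/-- The complexes induced from the `Σ 𝓗̃_H`, for the representatives `H` of rank `k`. -/
noncomputable abbrev suspFamily (H : RankIndex r T k) : ChainComplex (Contramodule R 𝓗) ℕ :=
  indComplex R H.1.1 (suspAugChains R 𝓗 H.1.1.sub)

variable {r T k} {n : ℕ}

variable (R) in
/-- The class of a map `f` and a chain in the coproduct of the complexes induced from the
`Σ 𝓗̃_H`. -/
noncomputable def coprodMk (H : RankIndex r T k) {L : Orb 𝓗} (f : L ⟶ H.1.1)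
    (s : Chains 𝓗 H.1.1.sub n) :
    ((ChainComplex.coprod (suspFamily R r T k)).X n).obj (Opposite.op L) :=
  (((ChainComplex.coprod.ι (suspFamily R r T k) H).f n).app (Opposite.op L)).hom
    (indMk ((suspAugChains R 𝓗 H.1.1.sub).X n) f (chainElt R s))

theorem map_coprodMk (H : RankIndex r T k) {L L' : Orb 𝓗} (f : L ⟶ H.1.1) (g : L' ⟶ L)
    (s : Chains 𝓗 H.1.1.sub n) :
    (((ChainComplex.coprod (suspFamily R r T k)).X n).map g.op).hom (coprodMk R H f s) =
      coprodMk R H (g ≫ f) s := by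
  have := congrArg ModuleCat.Hom.hom
    (((ChainComplex.coprod.ι (suspFamily R r T k) H).f n).naturality g.op)
  refine (LinearMap.congr_fun this
    (indMk ((suspAugChains R 𝓗 H.1.1.sub).X n) f (chainElt R s))).symm.trans ?_
  exact congrArg (((ChainComplex.coprod.ι (suspFamily R r T k) H).f n).app (Opposite.op L')).hom
    (ind_map_indMk ((suspAugChains R 𝓗 H.1.1.sub).X n) f g (chainElt R s))

theorem coprodMk_eq_of_res_eq (hT : IsSetOfRepresentatives T) {H H' : RankIndex r T k} {L : Orb 𝓗}
    {f : L ⟶ H.1.1} {f' : L ⟶ H'.1.1} {s : Chains 𝓗 H.1.1.sub n} {s' : Chains 𝓗 H'.1.1.sub n}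
    (h : (Flag.ofChain H.1.1 s).res f = (Flag.ofChain H'.1.1 s').res f') :
    coprodMk R H f s = coprodMk R H' f' s' := by
  obtain rfl : H = H' := Subtype.ext (Flag.eq_of_res_eq hT h)
  exact congrArg (((ChainComplex.coprod.ι (suspFamily R r T k) H).f n).app (Opposite.op L)).hom
    (indMk_eq_of_res_eq h)

theorem exists_rankIndex_res_eq (hT : IsSetOfRepresentatives T) {L : Orb 𝓗}
    (c : Flag 𝓗 L.sub n) (hc : c.rank r = k) :
    ∃ (H : RankIndex r T k) (f : L ⟶ H.1.1) (s : Chains 𝓗 H.1.1.sub n),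
      (Flag.ofChain H.1.1 s).res f = c := by
  obtain ⟨H, f, s, rfl⟩ := Flag.exists_res_eq hT c
  exact ⟨⟨H, by rwa [Flag.rank_res] at hc⟩, f, s, rfl⟩

open Classical in
variable (R) in
/-- A chain of rank `k`, presented by a representative. -/
noncomputable def gradedInvValue (hT : IsSetOfRepresentatives T) (L : Orb 𝓗)
    (c : Flag 𝓗 L.sub n) :
    ((ChainComplex.coprod (suspFamily R r T k)).X n).obj (Opposite.op L) :=
  if h : c.rank r = k then
    coprodMk R (exists_rankIndex_res_eq hT c h).choose
      (exists_rankIndex_res_eq hT c h).choose_spec.choose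
      (exists_rankIndex_res_eq hT c h).choose_spec.choose_spec.choose
  else 0

/-- All presentations of a flag have the same class, so the choice in `gradedInvValue` is
immaterial. -/
theorem gradedInvValue_res (hT : IsSetOfRepresentatives T) (H : RankIndex r T k) {L : Orb 𝓗}
    (f : L ⟶ H.1.1) (s : Chains 𝓗 H.1.1.sub n) :
    gradedInvValue (r := r) (k := k) R hT L ((Flag.ofChain H.1.1 s).res f) = coprodMk R H f s := by
  have h : ((Flag.ofChain H.1.1 s).res f).rank r = k := (Flag.rank_res r f _).trans H.2
  rw [gradedInvValue, dif_pos h]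
  exact coprodMk_eq_of_res_eq hT
    (exists_rankIndex_res_eq hT _ h).choose_spec.choose_spec.choose_spec

variable (R n) in
/-- The inverse of `gradedCoprodMap` in degree `n`. -/
noncomputable def gradedInv (hT : IsSetOfRepresentatives T) :
    layerModule r R {k} n ⟶ (ChainComplex.coprod (suspFamily R r T k)).X n :=
  layerModuleDesc r R (gradedInvValue R hT) fun L L' g c hc => by
    obtain ⟨H, f, s, rfl⟩ := exists_rankIndex_res_eq hT c hc
    rw [gradedInvValue_res, map_coprodMk, ← Flag.res_comp, gradedInvValue_res]

variable (R r T k) in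
/-- The map from the coproduct of the complexes induced from the `Σ 𝓗̃_H` to the chains of
rank `k`. -/
noncomputable def gradedCoprodMap :
    ChainComplex.coprod (suspFamily R r T k) ⟶ gradedComplex r R k :=
  ChainComplex.coprod.desc fun H => gradedMap k H.1.1 H.2

theorem gradedCoprodMap_coprodMk (H : RankIndex r T k) {L : Orb 𝓗} (f : L ⟶ H.1.1)
    (s : Chains 𝓗 H.1.1.sub n) :
    (((gradedCoprodMap R r T k).f n).app (Opposite.op L)).hom (coprodMk R H f s) =
      restrict R {k} ((Flag.ofChain H.1.1 s).res f) := by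
  have h : (ChainComplex.coprod.ι (suspFamily R r T k) H).f n ≫ (gradedCoprodMap R r T k).f n =
      (gradedMap k H.1.1 H.2).f n := ChainComplex.coprod.ι_descX _ H
  have h' := congrArg (fun φ : (suspFamily R r T k H).X n ⟶ layerModule r R {k} n =>
    (φ.app (Opposite.op L)).hom) h
  exact (LinearMap.congr_fun h' _).trans (gradedMap_indMk H.2 n f s)

/-- A flag of rank `k` is a representative `H`, a map to `G ⧸ H` and a chain in 𝓗_H, with the last
two unique up to `WH`. Both composites are checked on these generators. -/
theorem isIso_gradedCoprodMap (hT : IsSetOfRepresentatives T) :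
    IsIso (gradedCoprodMap R r T k) := by
  have (n : ℕ) : IsIso ((gradedCoprodMap R r T k).f n) := by
    refine ⟨gradedInv R n hT, ?_, ?_⟩
    · refine ChainComplex.coprod.hom_ext fun H => ind_chains_hom_ext fun L f s => ?_
      refine (congrArg ((gradedInv R n hT).app (Opposite.op L)).hom
        (gradedCoprodMap_coprodMk H f s)).trans ?_
      refine (layerModuleDesc_app_restrict r R _ _ ?_).trans (gradedInvValue_res hT H f s)
      exact (Flag.rank_res r f _).trans H.2
    · refine layerModule_hom_ext fun L c hc => ?_
      refine (congrArg (((gradedCoprodMap R r T k).f n).app (Opposite.op L)).hom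
        (layerModuleDesc_app_restrict r R _ _ hc)).trans ?_
      obtain ⟨H, f, s, rfl⟩ := exists_rankIndex_res_eq hT c hc
      rw [gradedInvValue_res]
      exact gradedCoprodMap_coprodMk H f s
  exact HomologicalComplex.Hom.isIso_of_components _

end GradedIso

/-! ### Resolving the layers -/

section Resolution

variable {r : Rank 𝓗} {T : Set (Orb 𝓗)}
  {P : ∀ H : Orb 𝓗, ChainComplex (Rep.{u} R (Weyl H.sub)) ℕ}
  (φ : ∀ H : Orb 𝓗, P H ⟶ suspAugChains R 𝓗 H.sub)

/-- The map from the complex induced from a resolution of `Σ 𝓗̃_H` to the chains of rank `k`. -/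
noncomputable def resolutionMap (k : ℕ) (H : RankIndex r T k) :
    indComplex R H.1.1 (P H.1.1) ⟶ gradedComplex r R k :=
  ((ind R H.1.1).mapHomologicalComplex _).map (φ H.1.1) ≫ gradedMap k H.1.1 H.2

/-- The map factors as the coproduct of the induced maps `φ H`, a quasi-isomorphism because
induction and coproducts are exact, followed by the isomorphism `gradedCoprodMap`. -/
theorem quasiIso_desc_resolutionMap (hT : IsSetOfRepresentatives T) (hφ : ∀ H, QuasiIso (φ H))
    (k : ℕ) : QuasiIso (ChainComplex.coprod.desc (resolutionMap (r := r) (T := T) φ k)) := by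
  have (H : RankIndex r T k) :
      QuasiIso (((ind R H.1.1).mapHomologicalComplex (ComplexShape.down ℕ)).map (φ H.1.1)) :=
    quasiIso_ind_map R _ _
  have := isIso_gradedCoprodMap (R := R) (r := r) (k := k) hT
  have h : ChainComplex.coprod.desc (resolutionMap (r := r) (T := T) φ k) =
      ChainComplex.coprod.map (fun H : RankIndex r T k =>
        ((ind R H.1.1).mapHomologicalComplex (ComplexShape.down ℕ)).map (φ H.1.1)) ≫
        gradedCoprodMap R r T k := by
    ext n : 1
    refine ChainComplex.coprod.hom_ext fun H => ?_
    refine (ChainComplex.coprod.ι_descX _ H).trans ?_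
    rw [HomologicalComplex.comp_f, ← Category.assoc, ChainComplex.coprod.ι_map_f, Category.assoc]
    exact congrArg
      ((((ind R H.1.1).mapHomologicalComplex (ComplexShape.down ℕ)).map (φ H.1.1)).f n ≫ ·)
      (ChainComplex.coprod.ι_descX (C := Contramodule R 𝓗)
      (fun H : RankIndex r T k => (gradedMap k H.1.1 H.2).f n) H).symm
  rw [h]
  infer_instance

end Resolution

/-! ### Length as a rank function -/

section Length

variable (𝓗) in
/-- Conjugation by `g` as an automorphism of the poset `𝓗`. -/
def conjOrderIso (g : G) :
    {K : Subgroup G // K ∈ 𝓗.carrier} ≃o {K : Subgroup G // K ∈ 𝓗.carrier} where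
  toFun K := ⟨MulAut.conj g • K.1, 𝓗.conj_mem g K.2⟩
  invFun K := ⟨MulAut.conj g⁻¹ • K.1, 𝓗.conj_mem g⁻¹ K.2⟩
  left_inv K := Subtype.ext (by simp)
  right_inv K := Subtype.ext (by simp)
  map_rel_iff' := Subgroup.pointwise_smul_le_pointwise_smul_iff

open Classical in
/-- The `𝓗`-length as a rank function. -/
noncomputable def lengthRank (hfin : ∀ H : Orb 𝓗, hLength H ≠ ⊤) : Rank 𝓗 where
  -- The value outside 𝓗 plays no role. Finiteness is essential: `toNat` sends `⊤` to 0, which would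
  -- break strict monotonicity.
  toFun K := if h : K ∈ 𝓗.carrier then (hLength ⟨K, h⟩).toNat else 0
  lt {K L} hK hL h := by
    rw [dif_pos hK, dif_pos hL, ← ENat.natCast_lt_natCast, ENat.natCast_toNat (hfin _),
      ENat.natCast_toNat (hfin _)]
    exact Order.height_strictMono (Subtype.mk_lt_mk.2 h) (hfin ⟨K, hK⟩).lt_top
  conj g K hK := by
    rw [dif_pos hK, dif_pos (𝓗.conj_mem g hK)]
    exact congrArg ENat.toNat (Order.height_orderIso (conjOrderIso 𝓗 g) ⟨K, hK⟩)

theorem lengthRank_apply (hfin : ∀ H : Orb 𝓗, hLength H ≠ ⊤) (H : Orb 𝓗) :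
    (lengthRank hfin).toFun H.sub = (hLength H).toNat :=
  dif_pos H.mem

end Length

end Bredon

/-! ### Assembly of the resolution -/

theorem mainTheorem2 {R G : Type u} [CommRing R] [Group G] (𝓗 : ClassOfSubgroups G)
    (hbound : ∃ b : ℕ, ∀ H : Bredon.Orb 𝓗, Bredon.hLength H ≤ b)
    (P : ∀ H : Bredon.Orb 𝓗, ChainComplex (Rep.{u} R (Bredon.Weyl H.sub)) ℕ)
    (hfree : ∀ (H : Bredon.Orb 𝓗) (n : ℕ),
      Module.Free R[Bredon.Weyl H.sub] ((P H).X n).ρ.asModule)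
    (φ : ∀ H : Bredon.Orb 𝓗, P H ⟶ Bredon.suspAugChains R 𝓗 H.sub)
    (hφ : ∀ H : Bredon.Orb 𝓗, QuasiIso (φ H))
    (T : Set (Bredon.Orb 𝓗)) (hT : Bredon.IsSetOfRepresentatives T) :
    ∃ (Q : ProjectiveResolution (Bredon.trivialContramodule R 𝓗))
      (e : ∀ n : ℕ, Q.complex.X n ≅ ∐ fun H : T => (Bredon.ind R H.1).obj ((P H.1).X n)),
      (∀ (n : ℕ) (H : T),
        Bredon.component ((e (n + 1)).inv ≫ Q.complex.d (n + 1) n ≫ (e n).hom) H H =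
          (Bredon.ind R H.1).map ((P H.1).d (n + 1) n)) ∧
      (∀ (n : ℕ) (H K : T), K ≠ H → Bredon.hLength K.1 ≤ Bredon.hLength H.1 →
        Bredon.component ((e (n + 1)).inv ≫ Q.complex.d (n + 1) n ≫ (e n).hom) H K = 0) := by
  obtain ⟨b, hb⟩ := hbound
  have hfin (H : Bredon.Orb 𝓗) : Bredon.hLength H ≠ ⊤ := ne_top_of_le_ne_top (by simp) (hb H)
  -- Lengths may equal `b`, so the filtration is first empty at `b + 1`, where the descending
  -- induction begins.
  have hrank (H : Bredon.Orb 𝓗) : (Bredon.lengthRank hfin).toFun H.sub < b + 1 := by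
    rw [Bredon.lengthRank_apply, Nat.lt_succ_iff]
    exact ENat.toNat_le_of_le_natCast (hb H)
  have hproj (H : T) (n : ℕ) : Projective ((Bredon.indComplex R H.1 (P H.1)).X n) := by
    have := hfree H.1 n
    have := Bredon.projective_of_free ((P H.1).X n)
    exact Bredon.projective_ind H.1 ((P H.1).X n)
  obtain ⟨M, ψ, hψ⟩ := ChainComplex.exists_filteredModel
    (r := fun H : T => (Bredon.lengthRank hfin).toFun H.1.sub) hproj
    (Bredon.upperInclusion (Bredon.lengthRank hfin) R)
    (Bredon.upperProjection (Bredon.lengthRank hfin) R)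
    (Bredon.upperInclusion_comp (Bredon.lengthRank hfin) R)
    (Bredon.upper_shortExact (Bredon.lengthRank hfin) R) (Bredon.resolutionMap φ)
    (Bredon.quasiIso_desc_resolutionMap φ hT hφ) (b + 1) (fun H => hrank H.1)
    (Bredon.upperComplex_acyclic (Bredon.lengthRank hfin) R _ fun K hK => hrank ⟨K, hK⟩) 0
    (Nat.zero_le _)
  obtain ⟨e, he⟩ := M.exists_iso
  have := Bredon.quasiIso_upperAugmentation (Bredon.lengthRank hfin) R
  refine ⟨{ complex := M.Q
            projective := fun n => Projective.of_iso (e n).symm inferInstance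
            -- At level 0 the filtration is the whole flag complex, so composing with its
            -- augmentation resolves the trivial contramodule.
            π := ψ ≫ Bredon.upperAugmentation (Bredon.lengthRank hfin) R }, e, fun n H => ?_,
    fun n H K hne hle => ?_⟩
  · exact (he n H H).trans (M.i_d_π_self n H (Nat.zero_le _))
  · refine (he n H K).trans (M.i_d_π_of_ne n H K hne.symm ?_)
    rw [Bredon.lengthRank_apply, Bredon.lengthRank_apply]
    exact ENat.toNat_le_toNat hle (hfin _)
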